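/- Let $\mathbb D$ be the open unit disc, $dA$ the area measure normalized by $A(\mathbb D)=1$, and $\omega\in L^1([0,1])$ a nonnegative function, extended to $\mathbb D$ by $\omega(z)=\omega(|z|)$. Put $\hat\omega(r)=\int_r^1\omega(t)\,dt$ and assume that $\hat\omega(r)>0$ for all $0\le r<1$ and that $\omega$ is two-sided doubling: there are constants $C_1\ge 1$, $K>1$, $C_2>1$ with $$\hat\omega(r)\le C_1\,\hat\omega\Big(\frac{1+r}{2}\Big)\quad\text{and}\quad \hat\omega(r)\ge C_2\,\hat\omega\Big(1-\frac{1-r}{K}\Big)\qquad(0\le r<1).$$ For $1<p<\infty$ let $A^p_\omega$ be the space of holomorphic functions $f$ on $\mathbb D$ with $\|f\|_{A^p_\omega}^p=\int_{\mathbb D}|f|^p\,\omega\,dA<\infty$. For $a\in\mathbb D$ and $0<s<1$ let $$E_s(a)=\Big\{z\in\mathbb D:\Big|\frac{a-z}{1-\bar a z}\Big|<s\Big\},\qquad S(a)=\Big\{re^{i\theta}:|a|\le r<1,\ |\operatorname{Arg}a-\theta|<\frac{1-|a|}{2}\Big\},$$ and $\omega(S(a))=\int_{S(a)}\omega\,dA$.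 For a bounded operator $T:X\to Y$ let $\|T\|_{e,X\to Y}=\inf\{\|T-K\|_{X\to Y}: K:X\to Y\text{ compact}\}$ be its essential norm. **Theorem.** Let $1<p\le q<\infty$, let $n\ge 0$ be an integer, let $\omega$ be as above and let $0<s<1$. There is a constant $C\in(0,\infty)$, depending only on $p,q,n,\omega,s$, such that for every positive Borel measure $\mu$ on $\mathbb D$ for which the operator $D^{(n)}:A^p_\omega\to L^q_\mu$, $f\mapsto f^{(n)}$, is bounded, $$\frac1C\,\limsup_{|z|\to1^-}\frac{\mu(E_s(z))}{(1-|z|)^{nq}\,\omega(S(z))^{q/p}}\ \le\ \|D^{(n)}\|_{e,A^p_\omega\to L^q_\mu}^q\ \le\ C\,\limsup_{|z|\to1^-}\frac{\mu(E_s(z))}{(1-|z|)^{nq}\,\omega(S(z))^{q/p}}.$$ -/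

import Mathlib

open MeasureTheory Set Filter Topology
open scoped ENNReal NNReal

noncomputable section

namespace BergmanDoubling

/-- The open unit disc of the complex plane. -/
abbrev disc : Set ℂ := Metric.ball (0 : ℂ) 1

/-! ### Radial weights and doubling conditions -/

/-- A radial weight is given by a nonnegative integrable function on `[0, 1]`; its value at a point
`z` of the disc is `ω ‖z‖`. -/
structure IsRadialWeight (ω : ℝ → ℝ) : Prop where
  nonneg : ∀ t ∈ Icc (0 : ℝ) 1, 0 ≤ ω t
  integrable : IntegrableOn ω (Icc (0 : ℝ) 1)

/-- The tail integral of `ω` over `[r, 1]`. -/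
def tail (ω : ℝ → ℝ) (r : ℝ) : ℝ := ∫ t in r..1, ω t

/-- The class of (upper) doubling weights. -/
structure IsDoubling (ω : ℝ → ℝ) : Prop extends IsRadialWeight ω where
  upper : ∃ C : ℝ, 1 ≤ C ∧ ∀ r ∈ Ico (0 : ℝ) 1, tail ω r ≤ C * tail ω ((r + 1) / 2)

/-- The class of two-sided doubling weights. -/
structure IsTwoSidedDoubling (ω : ℝ → ℝ) : Prop extends IsDoubling ω where
  lower : ∃ K : ℝ, 1 < K ∧ ∃ C : ℝ, 1 < C ∧
    ∀ r ∈ Ico (0 : ℝ) 1, C * tail ω (1 - (1 - r) / K) ≤ tail ω r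

/-- The measure `ω dA` on the disc, where `dA` is the area measure normalized by `A(disc) = 1`. -/
def weightMeasure (ω : ℝ → ℝ) : Measure ℂ :=
  (volume.restrict disc).withDensity fun z => ENNReal.ofReal (ω ‖z‖ / Real.pi)

/-- The Carleson square at `a`. -/
def carlesonSquare (a : ℂ) : Set ℂ :=
  {z | ∃ r θ : ℝ, ‖a‖ ≤ r ∧ r < 1 ∧ |a.arg - θ| < (1 - ‖a‖) / 2 ∧
    z = r * Complex.exp (θ * Complex.I)}

/-- The pseudohyperbolic disc with centre `a` and radius `s`. -/
def pseudoDisc (s : ℝ) (a : ℂ) : Set ℂ :=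
  {z | z ∈ disc ∧ ‖(a - z) / (1 - (starRingEnd ℂ) a * z)‖ < s}

/-! ### Weighted Bergman spaces -/

/-- The holomorphic functions on the disc that are `p`-integrable with respect to `ω dA`. A function
on the disc is represented by its extension by zero to the complex plane. -/
def bergmanSubmodule (p : ℝ≥0∞) (ω : ℝ → ℝ) : Submodule ℂ (ℂ → ℂ) where
  carrier := {f | DifferentiableOn ℂ f disc ∧ (∀ z, z ∉ disc → f z = 0) ∧
    MemLp f p (weightMeasure ω)}
  add_mem' := by
    rintro f g ⟨hf, hf0, hfp⟩ ⟨hg, hg0, hgp⟩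
    exact ⟨hf.add hg, fun z hz => by simp [hf0 z hz, hg0 z hz], hfp.add hgp⟩
  zero_mem' := ⟨differentiableOn_const 0, fun _ _ => rfl, MemLp.zero⟩
  smul_mem' := by
    rintro c f ⟨hf, hf0, hfp⟩
    exact ⟨hf.const_smul c, fun z hz => by simp [hf0 z hz], hfp.const_smul c⟩

/-- The weighted Bergman space as a type of its own, so that it carries the topology of its norm and
not the one of pointwise convergence. -/
def Bergman (p : ℝ≥0∞) (ω : ℝ → ℝ) : Type := bergmanSubmodule p ω

instance (p : ℝ≥0∞) (ω : ℝ → ℝ) : AddCommGroup (Bergman p ω) :=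
  inferInstanceAs (AddCommGroup (bergmanSubmodule p ω))

instance (p : ℝ≥0∞) (ω : ℝ → ℝ) : Module ℂ (Bergman p ω) :=
  inferInstanceAs (Module ℂ (bergmanSubmodule p ω))

/-- The function underlying an element of the Bergman space. -/
def Bergman.toFun {p : ℝ≥0∞} {ω : ℝ → ℝ} (f : Bergman p ω) : ℂ → ℂ := Subtype.val f

theorem Bergman.differentiableOn {p : ℝ≥0∞} {ω : ℝ → ℝ} (f : Bergman p ω) :
    DifferentiableOn ℂ f.toFun disc := (Subtype.property f).1

theorem Bergman.memLp {p : ℝ≥0∞} {ω : ℝ → ℝ} (f : Bergman p ω) :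
    MemLp f.toFun p (weightMeasure ω) := (Subtype.property f).2.2

theorem Bergman.toFun_add {p : ℝ≥0∞} {ω : ℝ → ℝ} (f g : Bergman p ω) :
    (f + g).toFun = f.toFun + g.toFun := rfl

theorem Bergman.toFun_smul {p : ℝ≥0∞} {ω : ℝ → ℝ} (c : ℂ) (f : Bergman p ω) :
    (c • f).toFun = c • f.toFun := rfl

/-- The inclusion of the Bergman space in `L^p(ω dA)`. -/
def Bergman.toLp (p : ℝ≥0∞) (ω : ℝ → ℝ) : Bergman p ω →ₗ[ℂ] Lp ℂ p (weightMeasure ω) where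
  toFun f := f.memLp.toLp f.toFun
  map_add' f g := MemLp.toLp_add f.memLp g.memLp
  map_smul' c f := MemLp.toLp_const_smul c f.memLp

/-- The Bergman space carries the norm of `L^p(ω dA)`. -/
instance (p : ℝ≥0∞) [Fact (1 ≤ p)] (ω : ℝ → ℝ) : SeminormedAddCommGroup (Bergman p ω) :=
  SeminormedAddCommGroup.induced (Bergman p ω) (Lp ℂ p (weightMeasure ω)) (Bergman.toLp p ω)

instance (p : ℝ≥0∞) [Fact (1 ≤ p)] (ω : ℝ → ℝ) : NormedSpace ℂ (Bergman p ω) :=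
  NormedSpace.induced ℂ (Bergman p ω) (Lp ℂ p (weightMeasure ω)) (Bergman.toLp p ω)

theorem Bergman.norm_def (p : ℝ≥0∞) [Fact (1 ≤ p)] (ω : ℝ → ℝ) (f : Bergman p ω) :
    ‖f‖ = (eLpNorm f.toFun p (weightMeasure ω)).toReal :=
  Lp.norm_toLp f.toFun f.memLp

/-! ### The differentiation operator -/

/-- `D^(n)` is bounded from the Bergman space to `L^q(μ)`, where `μ` is a Borel measure on the
disc (the restriction to the disc of a Borel measure on the plane). -/
def DiffBounded (p q : ℝ≥0∞) (ω : ℝ → ℝ) (n : ℕ) (μ : Measure ℂ) : Prop :=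
  ∃ C : ℝ≥0, ∀ f : Bergman p ω,
    eLpNorm (iteratedDeriv n f.toFun) q (μ.restrict disc) ≤
      C * eLpNorm f.toFun p (weightMeasure ω)

theorem Bergman.contDiffAt {p : ℝ≥0∞} {ω : ℝ → ℝ} (f : Bergman p ω) (n : ℕ) {z : ℂ}
    (hz : z ∈ disc) : ContDiffAt ℂ n f.toFun z :=
  (f.differentiableOn.analyticAt (Metric.isOpen_ball.mem_nhds hz)).contDiffAt

theorem Bergman.aestronglyMeasurable_iteratedDeriv {p : ℝ≥0∞} {ω : ℝ → ℝ} (f : Bergman p ω)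
    (n : ℕ) (μ : Measure ℂ) :
    AEStronglyMeasurable (iteratedDeriv n f.toFun) (μ.restrict disc) := by
  have h : ContinuousOn (iteratedDeriv n f.toFun) disc := by
    rw [iteratedDeriv_eq_iterate]
    exact ((f.differentiableOn.analyticOnNhd Metric.isOpen_ball).iterated_deriv n).continuousOn
  exact h.aestronglyMeasurable measurableSet_ball

theorem DiffBounded.memLp {p q : ℝ≥0∞} {ω : ℝ → ℝ} {n : ℕ} {μ : Measure ℂ}
    (h : DiffBounded p q ω n μ) (f : Bergman p ω) :
    MemLp (iteratedDeriv n f.toFun) q (μ.restrict disc) := by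
  obtain ⟨C, hC⟩ := h
  exact ⟨f.aestronglyMeasurable_iteratedDeriv n μ,
    (hC f).trans_lt (ENNReal.mul_lt_top ENNReal.coe_lt_top f.memLp.2)⟩

/-- The linear operator `f ↦ f^(n)` from the Bergman space to `L^q(μ)`. -/
def DiffBounded.linearMap {p q : ℝ≥0∞} {ω : ℝ → ℝ} {n : ℕ} {μ : Measure ℂ}
    (h : DiffBounded p q ω n μ) : Bergman p ω →ₗ[ℂ] Lp ℂ q (μ.restrict disc) where
  toFun f := (h.memLp f).toLp (iteratedDeriv n f.toFun)
  map_add' f g := by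
    rw [← MemLp.toLp_add]
    refine (MemLp.toLp_eq_toLp_iff _ _).2 ?_
    filter_upwards [ae_restrict_mem measurableSet_ball] with z hz
    rw [Bergman.toFun_add, iteratedDeriv_add (f.contDiffAt n hz) (g.contDiffAt n hz)]
    rfl
  map_smul' c f := by
    rw [RingHom.id_apply, ← MemLp.toLp_const_smul]
    refine (MemLp.toLp_eq_toLp_iff _ _).2 ?_
    filter_upwards [ae_restrict_mem measurableSet_ball] with z hz
    rw [Bergman.toFun_smul, iteratedDeriv_const_smul (f.contDiffAt n hz) c]
    rfl

/-- The bounded operator `D^(n) : f ↦ f^(n)` from the Bergman space to `L^q(μ)`. -/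
def DiffBounded.operator {p q : ℝ≥0∞} [Fact (1 ≤ p)] [Fact (1 ≤ q)] {ω : ℝ → ℝ} {n : ℕ}
    {μ : Measure ℂ} (h : DiffBounded p q ω n μ) :
    Bergman p ω →L[ℂ] Lp ℂ q (μ.restrict disc) :=
  LinearMap.mkContinuousOfExistsBound h.linearMap <| by
    have h' := h
    obtain ⟨C, hC⟩ := h'
    refine ⟨C, fun f => ?_⟩
    rw [Bergman.norm_def]
    refine (Lp.norm_toLp _ (h.memLp f)).trans_le ?_
    have := ENNReal.toReal_mono (ENNReal.mul_ne_top ENNReal.coe_ne_top f.memLp.2.ne) (hC f)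
    simpa [ENNReal.toReal_mul] using this

/-- The essential norm of a bounded operator: its distance to the compact operators. -/
def essNorm {X Y : Type*} [SeminormedAddCommGroup X] [NormedSpace ℂ X]
    [SeminormedAddCommGroup Y] [NormedSpace ℂ Y] (T : X →L[ℂ] Y) : ℝ :=
  sInf {t : ℝ | ∃ K : X →L[ℂ] Y, IsCompactOperator K ∧ t = ‖T - K‖}

/-- The quotient `μ(E_s(z)) / ((1 - |z|)^(nq) ω(S(z))^(q/p))`. -/
def carlesonQuotient (p q : ℝ≥0∞) (ω : ℝ → ℝ) (n : ℕ) (s : ℝ) (μ : Measure ℂ) (z : ℂ) : ℝ≥0∞ :=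
  μ (pseudoDisc s z) /
    (ENNReal.ofReal (1 - ‖z‖) ^ (n * q.toReal) *
      weightMeasure ω (carlesonSquare z) ^ (q.toReal / p.toReal))

end BergmanDoubling

end

/-! The essential norm of `f ↦ f^(n)` from a Bergman space to `L^q(μ)`.

All estimates are expressed through `squareSize ω |a| = (1 - |a|) ω̂(|a|)`, which is comparable with
the weighted area of the Carleson square at `a` once `|a| ≥ 1 / 2`.

*Upper estimate.* The circle means of `|f|^p` increase with the radius (by Jensen's inequality
for the Poisson integral), and lower doubling puts a fixed proportion of the tail at `r` between `r`
and `1 - (1 - r) / K`. Hence `ω` may be replaced, in bounding the norm from below, by the regular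
weight `ω̂(r) / (1 - r)` (`IsTwoSidedDoubling.exists_lintegral_tail_le`). As this weight is
essentially constant on discs of radius comparable to the distance to the circle, the sub-mean value
property gives `|f(z)|^p (1 - |z|) ω̂(|z|) ≲ ‖f‖^p`. Combined with the local estimate of derivatives
and Fubini's theorem this yields a Carleson embedding
(`IsTwoSidedDoubling.exists_embedding`): a bound `M` for the quotients outside a compact set bounds
the `q`-th power of the `L^q(μ)` norm of `f^(n)` near the circle by `C M ‖f‖^q`. On `|z| ≤ R` the
Taylor polynomials of `f^(n)` approximate it uniformly over the unit ball, so this part of the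
operator is a limit of operators of finite rank and does not contribute to the essential norm
(`DiffBounded.essNorm_le_of_tail`).

*Lower estimate.* The test functions are powers of `(1 - |a|) / (1 - conj a * z)`, normalized by
`squareSize`. Their norms are bounded because upper doubling controls the integral of a high power
of the kernel (`lintegral_kernel_le`), they tend to zero uniformly on compact sets as `|a| → 1`, and
their `n`-th derivatives have the expected size on the whole of `E_s(a)`
(`IsTwoSidedDoubling.exists_testFunctions`). A compact operator maps such a sequence to a null
sequence (`Bergman.tendsto_compactOperator`): sparse sums of `N` of its members have norm
`O(N^(1/p))`, whereas the images would add up to size `N` if they did not tend to zero. This is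
where `p > 1` is used, and it avoids the duality of the Bergman space. -/

noncomputable section

namespace BergmanDoubling

/-! ### Polar coordinates -/

/-- The integral of `G` over the circle of radius `r` about the origin, with respect to the angle
(so that the circle has total mass `2π`). -/
def circleMass (G : ℂ → ℝ≥0∞) (r : ℝ) : ℝ≥0∞ :=
  ∫⁻ θ in Ioc 0 (2 * Real.pi), G (circleMap 0 r θ)

theorem measurable_circleMap_uncurry (c : ℂ) :
    Measurable fun x : ℝ × ℝ => circleMap c x.1 x.2 := by
  unfold circleMap
  fun_prop

theorem measurable_circleMass {G : ℂ → ℝ≥0∞} (hG : Measurable G) : Measurable (circleMass G) := by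
  unfold circleMass
  exact (hG.comp (measurable_circleMap_uncurry 0)).lintegral_prod_right'

theorem setLIntegral_Ioc_periodic {g : ℝ → ℝ≥0∞} {T : ℝ} (hT : 0 < T)
    (hg : Function.Periodic g T) (a b : ℝ) :
    ∫⁻ θ in Ioc a (a + T), g θ = ∫⁻ θ in Ioc b (b + T), g θ := by
  have : VAddInvariantMeasure (AddSubgroup.zmultiples T) ℝ volume :=
    ⟨fun c s _ => measure_preimage_add _ _ _⟩
  exact (isAddFundamentalDomain_Ioc hT a).setLIntegral_eq (isAddFundamentalDomain_Ioc hT b) g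
    hg.map_vadd_zmultiples

theorem circleMass_eq_Ioc (G : ℂ → ℝ≥0∞) (r a : ℝ) :
    circleMass G r = ∫⁻ θ in Ioc a (a + 2 * Real.pi), G (circleMap 0 r θ) := by
  have h := setLIntegral_Ioc_periodic (g := fun θ => G (circleMap 0 r θ)) Real.two_pi_pos
    (fun θ => by simp only [periodic_circleMap 0 r θ]) 0 a
  rw [← h, zero_add, circleMass]

theorem lintegral_polar {G : ℂ → ℝ≥0∞} (hG : Measurable G) :
    ∫⁻ z, G z = ∫⁻ r in Ioi (0 : ℝ), ENNReal.ofReal r * circleMass G r := by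
  rw [← Complex.lintegral_comp_polarCoord_symm, polarCoord_target, Measure.volume_eq_prod,
    ← Measure.prod_restrict, lintegral_prod]
  · refine lintegral_congr fun r => ?_
    simp only [smul_eq_mul]
    rw [lintegral_const_mul']
    · rw [circleMass_eq_Ioc G r (-Real.pi)]
      congr 1
      rw [show -Real.pi + 2 * Real.pi = Real.pi by ring, setLIntegral_congr Ioo_ae_eq_Ioc]
      refine lintegral_congr fun θ => ?_
      simp [circleMap, Complex.exp_mul_I]
    · exact ENNReal.ofReal_ne_top
  · refine Measurable.aemeasurable ?_
    simp only [Complex.polarCoord_symm_apply]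
    fun_prop

theorem circleMass_congr {F G : ℂ → ℝ≥0∞} {r : ℝ} (hr : 0 ≤ r)
    (h : ∀ z, ‖z‖ = r → F z = G z) : circleMass F r = circleMass G r :=
  lintegral_congr fun θ => h _ (by simp [abs_of_nonneg hr])

theorem circleMass_zero (r : ℝ) : circleMass (fun _ => 0) r = 0 := by simp [circleMass]

theorem circleMass_const_mul (c : ℝ≥0∞) (hc : c ≠ ∞) (G : ℂ → ℝ≥0∞) (r : ℝ) :
    circleMass (fun z => c * G z) r = c * circleMass G r :=
  lintegral_const_mul' _ _ hc

theorem circleMass_radial (u : ℝ → ℝ≥0∞) (hu : ∀ t, u t ≠ ∞) (G : ℂ → ℝ≥0∞) {r : ℝ} (hr : 0 ≤ r) :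
    circleMass (fun z => u ‖z‖ * G z) r = u r * circleMass G r := by
  rw [← circleMass_const_mul _ (hu r)]
  exact circleMass_congr hr fun z hz => by rw [hz]

theorem setLIntegral_ball_polar {G : ℂ → ℝ≥0∞} (hG : Measurable G) (R : ℝ) :
    ∫⁻ z in Metric.ball 0 R, G z = ∫⁻ r in Ioo 0 R, ENNReal.ofReal r * circleMass G r := by
  rw [← lintegral_indicator measurableSet_ball, lintegral_polar (hG.indicator measurableSet_ball),
    ← lintegral_indicator measurableSet_Ioi, ← lintegral_indicator measurableSet_Ioo]
  refine lintegral_congr fun r => ?_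
  by_cases hr : 0 < r
  · rw [indicator_of_mem (show r ∈ Ioi (0 : ℝ) from hr)]
    by_cases hR : r < R
    · rw [indicator_of_mem (show r ∈ Ioo 0 R from ⟨hr, hR⟩)]
      congr 1
      exact circleMass_congr hr.le fun z hz => indicator_of_mem (by simpa [hz] using hR) _
    · rw [indicator_of_notMem (fun h : r ∈ Ioo 0 R => hR h.2),
        circleMass_congr hr.le (G := fun _ => 0)
          (fun z hz => indicator_of_notMem (by simpa [hz] using hR) _), circleMass_zero, mul_zero]
  · rw [indicator_of_notMem (show r ∉ Ioi (0 : ℝ) from hr),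
      indicator_of_notMem (fun h : r ∈ Ioo 0 R => hr h.1)]

/-! ### The radial measure and its tails -/

/-- The measure `ω(r) dr` on `(0, 1)`. -/
def radialMeasure (ω : ℝ → ℝ) : Measure ℝ :=
  (volume.restrict (Ioo 0 1)).withDensity fun r => ENNReal.ofReal (ω r)

variable {ω : ℝ → ℝ}

theorem IsRadialWeight.aemeasurable (hω : IsRadialWeight ω) :
    AEMeasurable (fun r => ENNReal.ofReal (ω r)) (volume.restrict (Ioo 0 1)) :=
  (hω.integrable.mono_set Ioo_subset_Icc_self).aestronglyMeasurable.aemeasurable.ennreal_ofReal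

theorem ae_radialMeasure_mem (ω : ℝ → ℝ) : ∀ᵐ r ∂radialMeasure ω, r ∈ Ioo (0 : ℝ) 1 :=
  (withDensity_absolutelyContinuous _ _).ae_le (ae_restrict_mem measurableSet_Ioo)

theorem radialMeasure_absolutelyContinuous (ω : ℝ → ℝ) : radialMeasure ω ≪ volume :=
  (withDensity_absolutelyContinuous _ _).trans Measure.restrict_le_self.absolutelyContinuous

instance (ω : ℝ → ℝ) : NullSingletonClass (radialMeasure ω) :=
  ⟨fun x => radialMeasure_absolutelyContinuous ω (measure_singleton x)⟩

theorem IsRadialWeight.isFiniteMeasure (hω : IsRadialWeight ω) :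
    IsFiniteMeasure (radialMeasure ω) := by
  refine isFiniteMeasure_withDensity_ofReal ?_
  exact (hω.integrable.mono_set Ioo_subset_Icc_self).2

/-- The mass of an interval under the radial measure is a difference of tails. -/
theorem IsRadialWeight.radialMeasure_Icc (hω : IsRadialWeight ω) {a b : ℝ} (ha : 0 ≤ a)
    (hab : a ≤ b) (hb : b ≤ 1) :
    radialMeasure ω (Icc a b) = ENNReal.ofReal (tail ω a - tail ω b) := by
  have hint : ∀ x y : ℝ, 0 ≤ x → x ≤ y → y ≤ 1 → IntervalIntegrable ω volume x y := by
    intro x y hx hxy hy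
    rw [intervalIntegrable_iff_integrableOn_Icc_of_le hxy]
    exact hω.integrable.mono_set (Icc_subset_Icc hx hy)
  have hd : tail ω a - tail ω b = ∫ t in a..b, ω t := by
    unfold tail
    rw [← intervalIntegral.integral_add_adjacent_intervals (hint a b ha hab hb)
      (hint b 1 (ha.trans hab) hb le_rfl)]
    ring
  have hae : Ioo a b =ᵐ[radialMeasure ω] Icc a b :=
    Ioo_ae_eq_Icc
  rw [← measure_congr hae, radialMeasure, withDensity_apply _ measurableSet_Ioo,
    Measure.restrict_restrict measurableSet_Ioo, inter_eq_left.2 (Ioo_subset_Ioo ha hb), hd,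
    intervalIntegral.integral_of_le hab, setLIntegral_congr Ioo_ae_eq_Ioc,
    ofReal_integral_eq_lintegral_ofReal]
  · exact hω.integrable.mono_set (Ioc_subset_Icc_self.trans (Icc_subset_Icc ha hb))
  · filter_upwards [ae_restrict_mem measurableSet_Ioc] with t ht
    exact hω.nonneg t ⟨ha.trans ht.1.le, ht.2.trans hb⟩

theorem tail_one (ω : ℝ → ℝ) : tail ω 1 = 0 := by simp [tail]

theorem IsRadialWeight.radialMeasure_Icc_one (hω : IsRadialWeight ω) {a : ℝ} (ha : 0 ≤ a)
    (ha1 : a ≤ 1) : radialMeasure ω (Icc a 1) = ENNReal.ofReal (tail ω a) := by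
  rw [hω.radialMeasure_Icc ha ha1 le_rfl, tail_one, sub_zero]

theorem IsRadialWeight.tail_nonneg (hω : IsRadialWeight ω) {a : ℝ} (ha : 0 ≤ a) (ha1 : a ≤ 1) :
    0 ≤ tail ω a :=
  intervalIntegral.integral_nonneg ha1 fun t ht => hω.nonneg t ⟨ha.trans ht.1, ht.2⟩

theorem IsRadialWeight.tail_anti (hω : IsRadialWeight ω) {a b : ℝ} (ha : 0 ≤ a) (hab : a ≤ b)
    (hb : b ≤ 1) : tail ω b ≤ tail ω a := by
  rw [← ENNReal.ofReal_le_ofReal_iff (hω.tail_nonneg ha (hab.trans hb)),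
    ← hω.radialMeasure_Icc_one ha (hab.trans hb), ← hω.radialMeasure_Icc_one (ha.trans hab) hb]
  exact measure_mono (Icc_subset_Icc_left hab)

theorem IsRadialWeight.radialMeasure_univ (hω : IsRadialWeight ω) :
    radialMeasure ω univ = ENNReal.ofReal (tail ω 0) := by
  rw [← hω.radialMeasure_Icc_one le_rfl zero_le_one]
  refine measure_congr ?_
  filter_upwards [ae_radialMeasure_mem ω] with r hr
  exact propext ⟨fun _ => ⟨hr.1.le, hr.2.le⟩, fun _ => trivial⟩

/-! ### The weighted area measure in polar coordinates -/

/-- A radial property holds almost everywhere on the disc if it holds for almost every radius. This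
lets the weight, known only up to null sets on `(0, 1)`, be replaced by a measurable one. -/
theorem ae_disc_of_ae_Ioo {P : ℝ → Prop} (h : ∀ᵐ r ∂volume.restrict (Ioo (0 : ℝ) 1), P r) :
    ∀ᵐ z : ℂ ∂volume.restrict disc, P ‖z‖ := by
  obtain ⟨N, hN, hNm, hN0⟩ := exists_measurable_superset_of_null (ae_iff.1 h)
  have hm : MeasurableSet {z : ℂ | ‖z‖ ∈ N} := measurable_norm hNm
  have h0 : (volume.restrict disc) {z : ℂ | ‖z‖ ∈ N} = 0 := by
    rw [← lintegral_indicator_one hm, setLIntegral_ball_polar (measurable_one.indicator hm),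
      lintegral_eq_zero_iff']
    · filter_upwards [measure_eq_zero_iff_ae_notMem.1 hN0, ae_restrict_mem measurableSet_Ioo]
        with r hr hr1
      rw [circleMass_congr hr1.1.le (G := fun _ => 0)
        (fun z hz => indicator_of_notMem (by simpa [hz] using hr) _), circleMass_zero, mul_zero]
      rfl
    · exact (ENNReal.measurable_ofReal.mul
        (measurable_circleMass (measurable_one.indicator hm))).aemeasurable
  filter_upwards [measure_eq_zero_iff_ae_notMem.1 h0] with z hz
  by_contra hP
  exact hz (hN hP)

theorem IsRadialWeight.lintegral_weightMeasure (hω : IsRadialWeight ω) {G : ℂ → ℝ≥0∞}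
    (hG : Measurable G) :
    ∫⁻ z, G z ∂weightMeasure ω =
      ∫⁻ r, ENNReal.ofReal (r / Real.pi) * circleMass G r ∂radialMeasure ω := by
  -- The measurable representative of the weight gives the same measures.
  let u := hω.aemeasurable.mk (fun r => ENNReal.ofReal (ω r))
  let v : ℝ → ℝ := fun r => (u r).toReal
  have hv : Measurable v := hω.aemeasurable.measurable_mk.ennreal_toReal
  have hωv : (fun r => ENNReal.ofReal (ω r)) =ᵐ[volume.restrict (Ioo 0 1)]
      fun r => ENNReal.ofReal (v r) := by
    filter_upwards [hω.aemeasurable.ae_eq_mk] with r hr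
    have : u r = ENNReal.ofReal (ω r) := hr.symm
    simp [v, this]
  have hπ := Real.pi_pos
  have h1 : weightMeasure ω = (volume.restrict disc).withDensity
      fun z => ENNReal.ofReal (v ‖z‖) * ENNReal.ofReal (1 / Real.pi) := by
    refine withDensity_congr_ae ?_
    filter_upwards [ae_disc_of_ae_Ioo hωv] with z hz
    rw [div_eq_mul_one_div, ENNReal.ofReal_mul' (by positivity), hz]
  have h3 : radialMeasure ω = (volume.restrict (Ioo 0 1)).withDensity
      fun r => ENNReal.ofReal (v r) := withDensity_congr_ae hωv
  have hmc := measurable_circleMass hG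
  rw [h1, h3, lintegral_withDensity_eq_lintegral_mul _ (by fun_prop) hG,
    lintegral_withDensity_eq_lintegral_mul _ (by fun_prop) (by fun_prop),
    setLIntegral_ball_polar (by fun_prop)]
  refine setLIntegral_congr_fun measurableSet_Ioo fun r hr => ?_
  simp only [Pi.mul_def]
  rw [circleMass_radial (fun r => ENNReal.ofReal (v r) * ENNReal.ofReal (1 / Real.pi))
    (fun t => ENNReal.mul_ne_top ENNReal.ofReal_ne_top ENNReal.ofReal_ne_top) G hr.1.le,
    div_eq_mul_one_div r, ENNReal.ofReal_mul hr.1.le]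
  ring

theorem ae_weightMeasure_mem_disc (ω : ℝ → ℝ) : ∀ᵐ z ∂weightMeasure ω, z ∈ disc :=
  (withDensity_absolutelyContinuous _ _).ae_le (ae_restrict_mem measurableSet_ball)

theorem circleMass_one (r : ℝ) : circleMass (fun _ => 1) r = ENNReal.ofReal (2 * Real.pi) := by
  simp [circleMass]

theorem IsRadialWeight.isFiniteMeasure_weightMeasure (hω : IsRadialWeight ω) :
    IsFiniteMeasure (weightMeasure ω) := by
  have := hω.isFiniteMeasure
  constructor
  have h := hω.lintegral_weightMeasure (G := fun _ => 1) measurable_const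
  rw [lintegral_one] at h
  rw [h]
  calc ∫⁻ r, ENNReal.ofReal (r / Real.pi) * circleMass (fun _ => 1) r ∂radialMeasure ω
      ≤ ∫⁻ r, ENNReal.ofReal 2 ∂radialMeasure ω := by
        refine lintegral_mono_ae ?_
        filter_upwards [ae_radialMeasure_mem ω] with r hr
        rw [circleMass_one, ← ENNReal.ofReal_mul (div_nonneg hr.1.le Real.pi_pos.le)]
        refine ENNReal.ofReal_le_ofReal ?_
        have := Real.pi_pos
        field_simp
        linarith [hr.2]
    _ < ∞ := by
        rw [lintegral_const]
        exact ENNReal.mul_lt_top ENNReal.ofReal_lt_top (measure_lt_top _ _)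

/-! ### The measure of a Carleson square -/

/-- A description of the Carleson square that is visibly measurable; rotating by `-arg a` first
keeps the branch cut of the argument away from the square. -/
theorem carlesonSquare_eq {a : ℂ} (ha : a ≠ 0) :
    carlesonSquare a = {z | ‖a‖ ≤ ‖z‖ ∧ ‖z‖ < 1 ∧
      |(z * Complex.exp (-a.arg * Complex.I)).arg| < (1 - ‖a‖) / 2} := by
  have ha' : 0 < ‖a‖ := norm_pos_iff.2 ha
  ext z
  constructor
  · rintro ⟨r, θ, h1, h2, h3, rfl⟩
    have hr : 0 < r := ha'.trans_le h1
    have hn : ‖(r : ℂ) * Complex.exp (θ * Complex.I)‖ = r := by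
      rw [norm_mul, Complex.norm_exp_ofReal_mul_I, Complex.norm_real, Real.norm_of_nonneg hr.le,
        mul_one]
    refine ⟨by rwa [hn], by rwa [hn], ?_⟩
    have hθ : θ - a.arg ∈ Ioc (-Real.pi) Real.pi := by
      have := Real.pi_gt_three
      rw [abs_lt] at h3
      constructor <;> linarith
    have he : (r : ℂ) * Complex.exp (θ * Complex.I) * Complex.exp (-a.arg * Complex.I) =
        r * Complex.exp ((θ - a.arg : ℝ) * Complex.I) := by
      rw [mul_assoc, ← Complex.exp_add]
      push_cast
      ring_nf
    rw [he, Complex.exp_mul_I, Complex.arg_real_mul _ hr, ← Complex.ofReal_cos,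
      ← Complex.ofReal_sin, Complex.ofReal_cos, Complex.ofReal_sin,
      Complex.arg_cos_add_sin_mul_I hθ, abs_sub_comm]
    exact h3
  · rintro ⟨h1, h2, h3⟩
    set β := (z * Complex.exp (-a.arg * Complex.I)).arg with hβ
    refine ⟨‖z‖, a.arg + β, h1, h2, by simpa using h3, ?_⟩
    have h := Complex.norm_mul_exp_arg_mul_I (z * Complex.exp (-a.arg * Complex.I))
    rw [← hβ, norm_mul, show (-(a.arg : ℂ)) = ((-a.arg : ℝ) : ℂ) by simp,
      Complex.norm_exp_ofReal_mul_I, mul_one] at h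
    push_cast
    rw [add_mul, Complex.exp_add, mul_left_comm, h, mul_left_comm, ← Complex.exp_add]
    simp

theorem measurableSet_carlesonSquare {a : ℂ} (ha : a ≠ 0) : MeasurableSet (carlesonSquare a) := by
  rw [carlesonSquare_eq ha]
  have h : Measurable fun z : ℂ => |(z * Complex.exp (-a.arg * Complex.I)).arg| :=
    (Complex.measurable_arg.comp (measurable_id.mul_const _)).norm
  exact (measurableSet_le measurable_const measurable_norm).inter
    ((measurableSet_lt measurable_norm measurable_const).inter
      (measurableSet_lt h measurable_const))

theorem circleMass_carlesonSquare {a : ℂ} (ha : a ≠ 0) {r : ℝ} (hr : 0 < r) (hr1 : r < 1) :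
    circleMass ((carlesonSquare a).indicator 1) r =
      (Icc ‖a‖ 1).indicator (fun _ => ENNReal.ofReal (1 - ‖a‖)) r := by
  have hπ := Real.pi_gt_three
  by_cases har : ‖a‖ ≤ r
  · rw [indicator_of_mem (show r ∈ Icc ‖a‖ 1 from ⟨har, hr1.le⟩),
      circleMass_eq_Ioc _ _ (a.arg - Real.pi)]
    have h : ∀ θ ∈ Ioc (a.arg - Real.pi) (a.arg - Real.pi + 2 * Real.pi),
        (carlesonSquare a).indicator (1 : ℂ → ℝ≥0∞) (circleMap 0 r θ) =
        (Ioo (a.arg - (1 - ‖a‖) / 2) (a.arg + (1 - ‖a‖) / 2)).indicator 1 θ := by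
      intro θ hθ
      have hθ' : θ - a.arg ∈ Ioc (-Real.pi) Real.pi := by
        constructor <;> linarith [hθ.1, hθ.2]
      have hm : circleMap 0 r θ ∈ carlesonSquare a ↔
          θ ∈ Ioo (a.arg - (1 - ‖a‖) / 2) (a.arg + (1 - ‖a‖) / 2) := by
        have he : circleMap 0 r θ * Complex.exp (-a.arg * Complex.I) =
            r * Complex.exp ((θ - a.arg : ℝ) * Complex.I) := by
          rw [circleMap, zero_add, mul_assoc, ← Complex.exp_add]
          push_cast
          ring_nf
        have hn : ‖circleMap 0 r θ‖ = r := by simp [abs_of_pos hr]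
        rw [carlesonSquare_eq ha, mem_ofPred_eq, hn, he, Complex.exp_mul_I,
          Complex.arg_real_mul _ hr, Complex.arg_cos_add_sin_mul_I hθ', abs_lt, mem_Ioo]
        constructor
        · rintro ⟨-, -, h1, h2⟩
          constructor <;> linarith
        · rintro ⟨h1, h2⟩
          exact ⟨har, hr1, by linarith, by linarith⟩
      by_cases hmem : circleMap 0 r θ ∈ carlesonSquare a
      · rw [indicator_of_mem hmem, indicator_of_mem (hm.1 hmem)]
        rfl
      · rw [indicator_of_notMem hmem, indicator_of_notMem (fun h => hmem (hm.2 h))]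
    rw [setLIntegral_congr_fun measurableSet_Ioc h, lintegral_indicator_one measurableSet_Ioo,
      Measure.restrict_apply measurableSet_Ioo, inter_eq_left.2, Real.volume_Ioo]
    · congr 1
      ring
    · have := norm_nonneg a
      intro θ hθ
      constructor <;> linarith [hθ.1, hθ.2]
  · rw [indicator_of_notMem (fun h : r ∈ Icc ‖a‖ 1 => har h.1),
      circleMass_congr hr.le (G := fun _ => 0), circleMass_zero]
    intro z hz
    refine indicator_of_notMem (fun h => ?_) _
    rw [carlesonSquare_eq ha] at h
    exact har (hz ▸ h.1)

theorem IsRadialWeight.weightMeasure_carlesonSquare (hω : IsRadialWeight ω) {a : ℂ} (ha : a ≠ 0) :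
    weightMeasure ω (carlesonSquare a) =
      ∫⁻ r in Icc ‖a‖ 1, ENNReal.ofReal (r / Real.pi) * ENNReal.ofReal (1 - ‖a‖)
        ∂radialMeasure ω := by
  have hm := measurableSet_carlesonSquare ha
  rw [← lintegral_indicator_one hm, hω.lintegral_weightMeasure (measurable_one.indicator hm),
    ← lintegral_indicator measurableSet_Icc]
  refine lintegral_congr_ae ?_
  filter_upwards [ae_radialMeasure_mem ω] with r hr
  rw [circleMass_carlesonSquare ha hr.1 hr.2]
  by_cases h : r ∈ Icc ‖a‖ 1
  · rw [indicator_of_mem h, indicator_of_mem h]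
  · rw [indicator_of_notMem h, indicator_of_notMem h, mul_zero]

/-- The size `(1 - r) ω̂(r)`, comparable with the `ω`-measure of a Carleson square at distance
`1 - r` from the unit circle. -/
def squareSize (ω : ℝ → ℝ) (r : ℝ) : ℝ := (1 - r) * tail ω r

theorem IsRadialWeight.weightMeasure_carlesonSquare_le (hω : IsRadialWeight ω) {a : ℂ}
    (ha : a ≠ 0) (ha1 : ‖a‖ < 1) :
    weightMeasure ω (carlesonSquare a) ≤ ENNReal.ofReal (squareSize ω ‖a‖) := by
  rw [hω.weightMeasure_carlesonSquare ha]
  calc _ ≤ ∫⁻ r in Icc ‖a‖ 1, ENNReal.ofReal (1 - ‖a‖) ∂radialMeasure ω := by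
        refine setLIntegral_mono measurable_const fun r hr => ?_
        rw [← ENNReal.ofReal_mul' (by linarith)]
        refine ENNReal.ofReal_le_ofReal (mul_le_of_le_one_left (by linarith) ?_)
        rw [div_le_one Real.pi_pos]
        linarith [hr.2, Real.pi_gt_three]
    _ = _ := by
        rw [setLIntegral_const, hω.radialMeasure_Icc_one (norm_nonneg a) ha1.le, squareSize,
          ENNReal.ofReal_mul (by linarith)]

theorem IsRadialWeight.le_weightMeasure_carlesonSquare (hω : IsRadialWeight ω) {a : ℂ}
    (ha : 1 / 2 ≤ ‖a‖) (ha1 : ‖a‖ < 1) :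
    ENNReal.ofReal (squareSize ω ‖a‖ / (2 * Real.pi)) ≤ weightMeasure ω (carlesonSquare a) := by
  have ha0 : a ≠ 0 := norm_pos_iff.1 (by linarith)
  have hπ := Real.pi_pos
  rw [hω.weightMeasure_carlesonSquare ha0]
  calc _ = ∫⁻ r in Icc ‖a‖ 1, ENNReal.ofReal (1 / 2 / Real.pi) * ENNReal.ofReal (1 - ‖a‖)
          ∂radialMeasure ω := by
        rw [setLIntegral_const, hω.radialMeasure_Icc_one (norm_nonneg a) ha1.le, squareSize,
          ← ENNReal.ofReal_mul (by positivity), ← ENNReal.ofReal_mul]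
        · congr 1
          field_simp
        · exact mul_nonneg (by positivity) (by linarith)
    _ ≤ _ := by
        refine setLIntegral_mono ?_ fun r hr => ?_
        · fun_prop
        · gcongr
          linarith [hr.1]

/-! ### Mean value inequalities for powers of holomorphic functions -/

theorem poissonKernel_nonneg {c w z : ℂ} (h : ‖w - c‖ ≤ ‖z - c‖) : 0 ≤ poissonKernel c w z := by
  rw [poissonKernel_def]
  have := norm_nonneg (w - c)
  exact div_nonneg (by nlinarith) (by positivity)

theorem continuous_poissonKernel_circleMap {c w : ℂ} {R : ℝ} (hw : w ∈ Metric.ball c R) :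
    Continuous fun θ => poissonKernel c w (circleMap c R θ) := by
  simp only [poissonKernel_def]
  refine Continuous.div (by fun_prop) (by fun_prop) fun θ => ?_
  have h : circleMap c R θ ≠ w := circleMap_ne_mem_ball hw θ
  rw [sub_sub_sub_cancel_right]
  exact pow_ne_zero 2 (norm_ne_zero_iff.2 (sub_ne_zero.2 h))

theorem lintegral_poissonKernel {c w : ℂ} {R : ℝ} (hw : w ∈ Metric.ball c R) :
    ∫⁻ θ in Ioc 0 (2 * Real.pi),
      ENNReal.ofReal ((2 * Real.pi)⁻¹ * poissonKernel c w (circleMap c R θ)) = 1 := by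
  have hR : 0 < R := Metric.pos_of_mem_ball hw
  have hπ := Real.two_pi_pos
  have hc := continuous_poissonKernel_circleMap hw
  have h := (diffContOnCl_const (c := (1 : ℝ → ℂ) 0) (𝕜 := ℂ)
    (s := Metric.ball c R)).circleAverage_poissonKernel_smul hw
  have h1 : (2 * Real.pi)⁻¹ * ∫ θ in 0..2 * Real.pi, poissonKernel c w (circleMap c R θ) = 1 := by
    have h2 : ((((2 * Real.pi)⁻¹ * ∫ θ in 0..2 * Real.pi,
        poissonKernel c w (circleMap c R θ) : ℝ)) : ℂ) = 1 := by
      rw [Complex.ofReal_mul, ← intervalIntegral.integral_ofReal]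
      simpa [Real.circleAverage_def] using h
    exact_mod_cast h2
  rw [← ofReal_integral_eq_lintegral_ofReal, integral_const_mul,
    ← intervalIntegral.integral_of_le hπ.le, h1, ENNReal.ofReal_one]
  · exact ((hc.const_mul _).integrableOn_Icc).mono_set Ioc_subset_Icc_self
  · refine Eventually.of_forall fun θ => mul_nonneg (by positivity) (poissonKernel_nonneg ?_)
    have := Metric.mem_ball.1 hw
    rw [dist_eq_norm] at this
    simpa [abs_of_pos hR] using this.le

/-- Jensen's inequality for the Poisson integral of a holomorphic function. -/
theorem enorm_rpow_le_poisson {f : ℂ → ℂ} {c w : ℂ} {R p : ℝ} (hp : 1 ≤ p)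
    (hf : DiffContOnCl ℂ f (Metric.ball c R)) (hw : w ∈ Metric.ball c R) :
    ‖f w‖ₑ ^ p ≤ ∫⁻ θ in Ioc 0 (2 * Real.pi),
      ENNReal.ofReal ((2 * Real.pi)⁻¹ * poissonKernel c w (circleMap c R θ)) *
        ‖f (circleMap c R θ)‖ₑ ^ p := by
  have hR : 0 < R := Metric.pos_of_mem_ball hw
  have hπ := Real.two_pi_pos
  have hK := continuous_poissonKernel_circleMap hw
  have hnn : ∀ θ, 0 ≤ poissonKernel c w (circleMap c R θ) := by
    intro θ
    refine poissonKernel_nonneg ?_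
    have := Metric.mem_ball.1 hw
    rw [dist_eq_norm] at this
    simpa [abs_of_pos hR] using this.le
  have hfc : Continuous fun θ => f (circleMap c R θ) := by
    refine hf.2.comp_continuous (continuous_circleMap c R) fun θ => ?_
    rw [closure_ball c hR.ne']
    exact Metric.sphere_subset_closedBall (circleMap_mem_sphere c hR.le θ)
  set k : ℝ → ℝ≥0∞ := fun θ =>
    ENNReal.ofReal ((2 * Real.pi)⁻¹ * poissonKernel c w (circleMap c R θ)) with hk
  have hkm : Measurable k := (ENNReal.continuous_ofReal.comp (hK.const_mul _)).measurable
  set ν : Measure ℝ := (volume.restrict (Ioc 0 (2 * Real.pi))).withDensity k with hν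
  have hν1 : IsProbabilityMeasure ν := by
    constructor
    rw [hν, withDensity_apply _ MeasurableSet.univ, setLIntegral_univ]
    exact lintegral_poissonKernel hw
  have h1 : ‖f w‖ₑ ≤ ∫⁻ θ, ‖f (circleMap c R θ)‖ₑ ∂ν := by
    rw [hν, lintegral_withDensity_eq_lintegral_mul _ hkm hfc.measurable.enorm]
    rw [← hf.circleAverage_poissonKernel_smul hw, Real.circleAverage_def,
      intervalIntegral.integral_of_le hπ.le, ← integral_smul]
    refine (enorm_integral_le_lintegral_enorm _).trans_eq (lintegral_congr fun θ => ?_)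
    simp only [Pi.mul_apply, hk, Pi.smul_apply', enorm_smul]
    rw [← mul_assoc, ENNReal.ofReal_mul (by positivity), Real.enorm_of_nonneg (by positivity),
      Real.enorm_of_nonneg (hnn θ)]
  have h2 := eLpNorm'_le_eLpNorm'_of_exponent_le one_pos hp ν
    (f := fun θ => f (circleMap c R θ)) hfc.aestronglyMeasurable
  simp only [eLpNorm', ENNReal.rpow_one, div_one] at h2
  have hp0 : 0 < p := by linarith
  calc ‖f w‖ₑ ^ p ≤ ((∫⁻ θ, ‖f (circleMap c R θ)‖ₑ ^ p ∂ν) ^ (1 / p)) ^ p :=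
        ENNReal.rpow_le_rpow (h1.trans h2) hp0.le
    _ = ∫⁻ θ, ‖f (circleMap c R θ)‖ₑ ^ p ∂ν := by
        rw [← ENNReal.rpow_mul, one_div_mul_cancel hp0.ne', ENNReal.rpow_one]
    _ = _ := by
        rw [hν, lintegral_withDensity_eq_lintegral_mul _ hkm
          (hfc.measurable.enorm.pow_const p)]
        rfl

/-- The Poisson kernel depends only on the difference of the angles. -/
theorem poissonKernel_comm_circleMap (r R θ t : ℝ) :
    poissonKernel 0 (circleMap 0 r t) (circleMap 0 R θ) =
      poissonKernel 0 (circleMap 0 r θ) (circleMap 0 R t) := by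
  have h : ∀ a b : ℝ, ‖circleMap 0 R a - circleMap 0 r b‖ ^ 2 =
      R ^ 2 + r ^ 2 - 2 * (R * r) * Real.cos (a - b) := by
    intro a b
    rw [← Complex.normSq_eq_norm_sq, Complex.normSq_apply]
    simp only [circleMap, zero_add, Complex.sub_re, Complex.sub_im, Complex.re_ofReal_mul,
      Complex.im_ofReal_mul, Complex.exp_ofReal_mul_I_re, Complex.exp_ofReal_mul_I_im, Real.cos_sub]
    linear_combination R ^ 2 * Real.sin_sq_add_cos_sq a + r ^ 2 * Real.sin_sq_add_cos_sq b
  simp only [poissonKernel_def, sub_zero, h]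
  rw [← neg_sub θ t, Real.cos_neg]
  simp

/-- The `p`-th power means over circles of a function holomorphic on the disc increase with the
radius. -/
theorem circleMass_mono {f : ℂ → ℂ} {p r t : ℝ} (hp : 1 ≤ p) (hf : DifferentiableOn ℂ f disc)
    (hfm : Measurable f) (hr : 0 ≤ r) (hrt : r ≤ t) (ht : t < 1) :
    circleMass (fun z => ‖f z‖ₑ ^ p) r ≤ circleMass (fun z => ‖f z‖ₑ ^ p) t := by
  rcases hrt.eq_or_lt with rfl | hrt
  · exact le_rfl
  have ht0 : 0 < t := hr.trans_lt hrt
  have hd : DiffContOnCl ℂ f (Metric.ball 0 t) := by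
    refine DifferentiableOn.diffContOnCl ?_
    rw [closure_ball _ ht0.ne']
    exact hf.mono (Metric.closedBall_subset_ball ht)
  have hmem : ∀ θ, circleMap 0 r θ ∈ Metric.ball (0 : ℂ) t := fun θ => by
    simpa [abs_of_nonneg hr] using hrt
  have hjm : Measurable fun x : ℝ × ℝ => ENNReal.ofReal ((2 * Real.pi)⁻¹ *
      poissonKernel 0 (circleMap 0 r x.1) (circleMap 0 t x.2)) *
        ‖f (circleMap 0 t x.2)‖ₑ ^ p := by
    simp only [poissonKernel_def]
    fun_prop
  calc circleMass (fun z => ‖f z‖ₑ ^ p) r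
      ≤ ∫⁻ s in Ioc 0 (2 * Real.pi), ∫⁻ θ in Ioc 0 (2 * Real.pi),
        ENNReal.ofReal ((2 * Real.pi)⁻¹ * poissonKernel 0 (circleMap 0 r s) (circleMap 0 t θ)) *
        ‖f (circleMap 0 t θ)‖ₑ ^ p :=
        lintegral_mono fun s => enorm_rpow_le_poisson hp hd (hmem s)
    _ = ∫⁻ θ in Ioc 0 (2 * Real.pi), (∫⁻ s in Ioc 0 (2 * Real.pi),
        ENNReal.ofReal ((2 * Real.pi)⁻¹ * poissonKernel 0 (circleMap 0 r θ) (circleMap 0 t s))) *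
        ‖f (circleMap 0 t θ)‖ₑ ^ p := by
        rw [lintegral_lintegral_swap hjm.aemeasurable]
        refine lintegral_congr fun θ => ?_
        rw [lintegral_mul_const]
        · simp only [poissonKernel_comm_circleMap r t θ]
        · simp only [poissonKernel_def]
          fun_prop
    _ = circleMass (fun z => ‖f z‖ₑ ^ p) t := by
        refine lintegral_congr fun θ => ?_
        rw [lintegral_poissonKernel (hmem θ), one_mul]

/-- The integral of `1 / |1 - conj a * z|²` over a circle, read off from the normalization of the
Poisson kernel of the unit circle. -/
theorem lintegral_circle_inv_sq {a : ℂ} {r : ℝ} (hr : 0 ≤ r) (har : ‖a‖ * r < 1) :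
    circleMass (fun z => ENNReal.ofReal (‖1 - (starRingEnd ℂ) a * z‖ ^ 2)⁻¹) r =
      ENNReal.ofReal (2 * Real.pi / (1 - (‖a‖ * r) ^ 2)) := by
  have hw : (r : ℂ) * a ∈ Metric.ball (0 : ℂ) 1 := by
    simpa [abs_of_nonneg hr, mul_comm] using har
  have hπ := Real.two_pi_pos
  have hpos : 0 < 1 - (‖a‖ * r) ^ 2 := by
    have : 0 ≤ ‖a‖ * r := by positivity
    nlinarith
  have h := lintegral_poissonKernel hw
  have he : ∀ θ : ℝ, ENNReal.ofReal (‖1 - (starRingEnd ℂ) a * circleMap 0 r θ‖ ^ 2)⁻¹ =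
      ENNReal.ofReal (2 * Real.pi / (1 - (‖a‖ * r) ^ 2)) * ENNReal.ofReal ((2 * Real.pi)⁻¹ *
        poissonKernel 0 ((r : ℂ) * a) (circleMap 0 1 θ)) := by
    intro θ
    have hn : ‖1 - (starRingEnd ℂ) a * circleMap 0 r θ‖ = ‖circleMap 0 1 θ - r * a‖ := by
      have hu : ‖Complex.exp (θ * Complex.I)‖ = 1 := Complex.norm_exp_ofReal_mul_I θ
      have hcu : (starRingEnd ℂ) (Complex.exp (θ * Complex.I)) *
          Complex.exp (θ * Complex.I) = 1 := by
        rw [mul_comm, Complex.mul_conj, Complex.normSq_eq_norm_sq, hu]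
        simp
      have e : 1 - (starRingEnd ℂ) a * circleMap 0 r θ =
          (starRingEnd ℂ) (circleMap 0 1 θ - r * a) * Complex.exp (θ * Complex.I) := by
        simp only [circleMap, zero_add, Complex.ofReal_one, one_mul, map_sub, map_mul,
          Complex.conj_ofReal]
        linear_combination -hcu
      rw [e, norm_mul, hu, mul_one, RCLike.norm_conj]
    rw [← ENNReal.ofReal_mul (by positivity), hn, poissonKernel_def]
    congr 1
    simp only [sub_zero, norm_circleMap_zero, abs_one, norm_mul, Complex.norm_real,
      Real.norm_of_nonneg hr]
    rw [show (1 : ℝ) ^ 2 - (r * ‖a‖) ^ 2 = 1 - (‖a‖ * r) ^ 2 by ring, div_mul_eq_mul_div,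
      mul_inv_cancel_left₀ hπ.ne', div_div_cancel_left' hpos.ne']
  unfold circleMass
  simp only [he]
  rw [lintegral_const_mul' _ _ ENNReal.ofReal_ne_top, h, mul_one]

/-- The sub-mean value property over discs for powers of a holomorphic function. -/
theorem enorm_rpow_le_setLIntegral_ball {f : ℂ → ℂ} {c : ℂ} {ρ p : ℝ} (hp : 1 ≤ p) (hρ : 0 < ρ)
    (hf : DifferentiableOn ℂ f (Metric.ball c ρ)) (hfm : Measurable f) :
    ‖f c‖ₑ ^ p ≤ ENNReal.ofReal (1 / (Real.pi * ρ ^ 2)) *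
      ∫⁻ z in Metric.ball c ρ, ‖f z‖ₑ ^ p := by
  have hπ := Real.pi_pos
  have h1 : ∀ r ∈ Ioo 0 ρ, ENNReal.ofReal (2 * Real.pi) * ‖f c‖ₑ ^ p ≤
      circleMass (fun z => ‖f (c + z)‖ₑ ^ p) r := by
    intro r hr
    have hd : DiffContOnCl ℂ f (Metric.ball c r) := by
      refine DifferentiableOn.diffContOnCl ?_
      rw [closure_ball _ hr.1.ne']
      exact hf.mono (Metric.closedBall_subset_ball hr.2)
    have h := enorm_rpow_le_poisson hp hd (Metric.mem_ball_self hr.1)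
    have he : ∀ θ, ENNReal.ofReal ((2 * Real.pi)⁻¹ * poissonKernel c c (circleMap c r θ)) *
        ‖f (circleMap c r θ)‖ₑ ^ p =
        ENNReal.ofReal (2 * Real.pi)⁻¹ * ‖f (c + circleMap 0 r θ)‖ₑ ^ p := by
      intro θ
      have : poissonKernel c c (circleMap c r θ) = 1 := by
        simp [poissonKernel_def, hr.1.ne']
      rw [this, mul_one]
      simp [circleMap]
    simp only [he] at h
    rw [lintegral_const_mul' _ _ ENNReal.ofReal_ne_top] at h
    calc _ ≤ ENNReal.ofReal (2 * Real.pi) * (ENNReal.ofReal (2 * Real.pi)⁻¹ *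
          circleMass (fun z => ‖f (c + z)‖ₑ ^ p) r) := by gcongr; exact h
      _ = _ := by
        rw [← mul_assoc, ← ENNReal.ofReal_mul (by positivity), mul_inv_cancel₀ (by positivity),
          ENNReal.ofReal_one, one_mul]
  have h2 : ∫⁻ z in Metric.ball c ρ, ‖f z‖ₑ ^ p =
      ∫⁻ z in Metric.ball 0 ρ, ‖f (c + z)‖ₑ ^ p := by
    rw [← lintegral_indicator measurableSet_ball, ← lintegral_indicator measurableSet_ball,
      ← lintegral_add_left_eq_self _ c]
    refine lintegral_congr fun z => ?_
    simp [indicator]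
  rw [h2, setLIntegral_ball_polar (by fun_prop)]
  have h3 : ENNReal.ofReal (Real.pi * ρ ^ 2) * ‖f c‖ₑ ^ p ≤
      ∫⁻ r in Ioo 0 ρ, ENNReal.ofReal r * circleMass (fun z => ‖f (c + z)‖ₑ ^ p) r := by
    calc _ = ∫⁻ r in Ioo 0 ρ, ENNReal.ofReal r * (ENNReal.ofReal (2 * Real.pi) * ‖f c‖ₑ ^ p) := by
          rw [lintegral_mul_const _ ENNReal.measurable_ofReal, ← mul_assoc]
          congr 1
          rw [← ofReal_integral_eq_lintegral_ofReal, ← integral_Ioc_eq_integral_Ioo,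
            ← intervalIntegral.integral_of_le hρ.le, integral_id,
            ← ENNReal.ofReal_mul (by
              simp only [ne_eq, OfNat.ofNat_ne_zero, not_false_eq_true, zero_pow, sub_zero]
              positivity)]
          · congr 1
            ring
          · exact (continuous_id.integrableOn_Icc).mono_set Ioo_subset_Icc_self
          · filter_upwards [ae_restrict_mem measurableSet_Ioo] with r hr using hr.1.le
      _ ≤ _ := setLIntegral_mono' measurableSet_Ioo fun r hr => by gcongr; exact h1 r hr
  calc ‖f c‖ₑ ^ p = ENNReal.ofReal (1 / (Real.pi * ρ ^ 2)) *
        (ENNReal.ofReal (Real.pi * ρ ^ 2) * ‖f c‖ₑ ^ p) := by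
        rw [← mul_assoc, ← ENNReal.ofReal_mul (by positivity), one_div_mul_cancel (by positivity),
          ENNReal.ofReal_one, one_mul]
    _ ≤ _ := by gcongr

/-- A local estimate for the `n`-th derivative by the mean over a disc. -/
theorem enorm_iteratedDeriv_rpow_le {f : ℂ → ℂ} {c : ℂ} {ρ p : ℝ} (n : ℕ) (hp : 1 ≤ p)
    (hρ : 0 < ρ) (hf : DifferentiableOn ℂ f (Metric.ball c ρ)) (hfm : Measurable f) :
    ‖iteratedDeriv n f c‖ₑ ^ p ≤
      ENNReal.ofReal (((n.factorial : ℝ) * (2 / ρ) ^ n) ^ p * (4 / (Real.pi * ρ ^ 2))) *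
      ∫⁻ z in Metric.ball c ρ, ‖f z‖ₑ ^ p := by
  have hπ := Real.pi_pos
  have hp0 : 0 < p := by linarith
  set A := ENNReal.ofReal (4 / (Real.pi * ρ ^ 2)) * ∫⁻ z in Metric.ball c ρ, ‖f z‖ₑ ^ p with hA
  have hρ2 : 0 < ρ / 2 := by positivity
  have hs : ∀ z ∈ Metric.sphere c (ρ / 2), ‖f z‖ₑ ^ p ≤ A := by
    intro z hz
    have hsub : Metric.ball z (ρ / 2) ⊆ Metric.ball c ρ := by
      refine Metric.ball_subset_ball' ?_
      rw [Metric.mem_sphere.1 hz]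
      linarith
    calc _ ≤ _ := enorm_rpow_le_setLIntegral_ball hp hρ2 (hf.mono hsub) hfm
      _ ≤ A := by
        rw [hA]
        refine mul_le_mul' (le_of_eq ?_) (lintegral_mono_set hsub)
        congr 1
        field_simp
        norm_num
  have hd : DiffContOnCl ℂ f (Metric.ball c (ρ / 2)) := by
    refine DifferentiableOn.diffContOnCl ?_
    rw [closure_ball _ hρ2.ne']
    exact hf.mono (Metric.closedBall_subset_ball (by linarith))
  have hK0 : 0 < ((n.factorial : ℝ) * (2 / ρ) ^ n) ^ p * (4 / (Real.pi * ρ ^ 2)) := by positivity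
  rcases eq_or_ne A ∞ with hAt | hAt
  · have : ∫⁻ z in Metric.ball c ρ, ‖f z‖ₑ ^ p = ∞ := by
      by_contra hne
      exact ENNReal.mul_ne_top ENNReal.ofReal_ne_top hne hAt
    rw [this, ENNReal.mul_top (by simpa using hK0)]
    exact le_top
  · set a := A ^ (1 / p) with ha
    have hat : a ≠ ∞ := ENNReal.rpow_ne_top_of_nonneg (by positivity) hAt
    have hn : ‖iteratedDeriv n f c‖ ≤ n.factorial * a.toReal / (ρ / 2) ^ n := by
      refine Complex.norm_iteratedDeriv_le_of_forall_mem_sphere_norm_le n hρ2 hd fun z hz => ?_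
      have h1 : ‖f z‖ₑ ≤ a := by
        rw [ha, one_div, ENNReal.le_rpow_inv_iff hp0]
        exact hs z hz
      have := ENNReal.toReal_mono hat h1
      simpa using this
    have he : ‖iteratedDeriv n f c‖ₑ ≤ ENNReal.ofReal (n.factorial * (2 / ρ) ^ n) * a := by
      rw [← ofReal_norm, ← ENNReal.ofReal_toReal hat, ← ENNReal.ofReal_mul (by positivity)]
      refine ENNReal.ofReal_le_ofReal (hn.trans_eq ?_)
      rw [div_pow, div_pow]
      field_simp
    calc ‖iteratedDeriv n f c‖ₑ ^ p ≤ (ENNReal.ofReal (n.factorial * (2 / ρ) ^ n) * a) ^ p :=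
          ENNReal.rpow_le_rpow he hp0.le
      _ = _ := by
          rw [ENNReal.mul_rpow_of_nonneg _ _ hp0.le, ha, ← ENNReal.rpow_mul,
            one_div_mul_cancel hp0.ne', ENNReal.rpow_one, ENNReal.ofReal_rpow_of_nonneg
            (by positivity) hp0.le, hA, ← mul_assoc, ← ENNReal.ofReal_mul (by positivity)]

/-! ### Norm estimates in the Bergman space -/

theorem measurable_radialMeasure_Icc (ω : ℝ → ℝ) :
    Measurable fun r => radialMeasure ω (Icc r 1) :=
  Antitone.measurable fun _ _ h => measure_mono (Icc_subset_Icc_left h)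

/-- The invariant length of `{r : r ≤ t ≤ 1 - (1 - r) / K}` does not depend on `t`. -/
theorem lintegral_inv_one_sub_le {K t : ℝ} (hK : 1 < K) (ht : t < 1) :
    ∫⁻ r in Ioo 0 1, {r | r ≤ t ∧ t ≤ 1 - (1 - r) / K}.indicator
      (fun r => ENNReal.ofReal (1 - r)⁻¹) r ≤ ENNReal.ofReal (K - 1) := by
  have hK0 : 0 < K := by linarith
  have ht' : 0 < 1 - t := by linarith
  calc _ ≤ ∫⁻ r, (Icc (1 - K * (1 - t)) t).indicator (fun _ => ENNReal.ofReal (1 - t)⁻¹) r := by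
        refine (setLIntegral_le_lintegral _ _).trans (lintegral_mono fun r => ?_)
        by_cases hr : r ≤ t ∧ t ≤ 1 - (1 - r) / K
        · have h2 : (1 - r) / K ≤ 1 - t := by linarith [hr.2]
          rw [div_le_iff₀ hK0] at h2
          rw [indicator_of_mem (show r ∈ {r | r ≤ t ∧ t ≤ 1 - (1 - r) / K} from hr),
            indicator_of_mem (show r ∈ Icc (1 - K * (1 - t)) t from ⟨by linarith, hr.1⟩)]
          refine ENNReal.ofReal_le_ofReal (inv_anti₀ ht' (by linarith [hr.1]))
        · rw [indicator_of_notMem (show r ∉ {r | r ≤ t ∧ t ≤ 1 - (1 - r) / K} from hr)]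
          exact zero_le
    _ = ENNReal.ofReal (K - 1) := by
        rw [lintegral_indicator measurableSet_Icc, setLIntegral_const, Real.volume_Icc,
          ← ENNReal.ofReal_mul (by positivity)]
        congr 1
        field_simp
        ring

/-- On the Bergman space the weight may be replaced by its regularization `ω̂(r) / (1 - r)`. The
lower doubling condition puts a fixed proportion of the tail at `r` on the interval from `r` to
`1 - (1 - r) / K`, where the circle means of `|f|^p` are larger than at `r`. -/
theorem IsTwoSidedDoubling.exists_lintegral_tail_le (hω : IsTwoSidedDoubling ω) {p : ℝ}
    (hp : 1 ≤ p) :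
    ∃ C : ℝ, 0 < C ∧ ∀ f : ℂ → ℂ, DifferentiableOn ℂ f disc → Measurable f →
      ∫⁻ z in disc, ENNReal.ofReal (tail ω ‖z‖ / (1 - ‖z‖)) * ‖f z‖ₑ ^ p ≤
        ENNReal.ofReal C * ∫⁻ z, ‖f z‖ₑ ^ p ∂weightMeasure ω := by
  have hr := hω.toIsRadialWeight
  have := hr.isFiniteMeasure
  obtain ⟨K, hK, C₂, hC₂, hlow⟩ := hω.lower
  have hπ := Real.pi_pos
  have hK0 : 0 < K := by linarith
  have hc : 0 < C₂ / (C₂ - 1) := div_pos (by linarith) (by linarith)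
  refine ⟨C₂ / (C₂ - 1) * (K - 1) * Real.pi,
    mul_pos (mul_pos hc (by linarith)) hπ, fun f hf hfm => ?_⟩
  set g : ℂ → ℝ≥0∞ := fun z => ‖f z‖ₑ ^ p with hg
  have hgm : Measurable g := hfm.enorm.pow_const p
  set N : ℝ → ℝ≥0∞ := fun t => ENNReal.ofReal t * circleMass g t with hN
  have hNm : Measurable N := ENNReal.measurable_ofReal.mul (measurable_circleMass hgm)
  set S : Set (ℝ × ℝ) := {x | x.1 ≤ x.2 ∧ x.2 ≤ 1 - (1 - x.1) / K} with hS
  have hSm : MeasurableSet S :=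
    (measurableSet_le measurable_fst measurable_snd).inter
      (measurableSet_le measurable_snd (by fun_prop))
  set F : ℝ → ℝ → ℝ≥0∞ := fun r t =>
    S.indicator (fun x => ENNReal.ofReal (1 - x.1)⁻¹ * N x.2) (r, t) with hF
  have hFm : Measurable (Function.uncurry F) := by
    have h : Measurable fun x : ℝ × ℝ => ENNReal.ofReal (1 - x.1)⁻¹ * N x.2 := by fun_prop
    exact h.indicator hSm
  have hpt : ∀ r ∈ Ioo (0 : ℝ) 1,
      ENNReal.ofReal r * (radialMeasure ω (Icc r 1) * ENNReal.ofReal (1 - r)⁻¹ *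
        circleMass g r) ≤
      ENNReal.ofReal (C₂ / (C₂ - 1)) * ∫⁻ t, F r t ∂radialMeasure ω := by
    intro r hr1
    have h1r : 0 < 1 - r := by linarith [hr1.2]
    have hφ : (1 - r) / K < 1 - r := div_lt_self h1r hK
    have hφ0 : 0 < (1 - r) / K := by positivity
    have h1 : radialMeasure ω (Icc r 1) ≤
        ENNReal.ofReal (C₂ / (C₂ - 1)) * radialMeasure ω (Icc r (1 - (1 - r) / K)) := by
      rw [hr.radialMeasure_Icc_one hr1.1.le hr1.2.le,
        hr.radialMeasure_Icc hr1.1.le (by linarith) (by linarith), ← ENNReal.ofReal_mul hc.le]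
      refine ENNReal.ofReal_le_ofReal ?_
      have := hlow r ⟨hr1.1.le, hr1.2⟩
      rw [div_mul_eq_mul_div, le_div_iff₀ (by linarith)]
      nlinarith
    have h2 : ENNReal.ofReal (1 - r)⁻¹ * N r * radialMeasure ω (Icc r (1 - (1 - r) / K)) ≤
        ∫⁻ t, F r t ∂radialMeasure ω := by
      calc _ = ∫⁻ t in Icc r (1 - (1 - r) / K), ENNReal.ofReal (1 - r)⁻¹ * N r
              ∂radialMeasure ω := by rw [setLIntegral_const]
        _ ≤ ∫⁻ t in Icc r (1 - (1 - r) / K), ENNReal.ofReal (1 - r)⁻¹ * N t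
              ∂radialMeasure ω := by
            refine setLIntegral_mono (by fun_prop) fun t ht => ?_
            have := circleMass_mono hp hf hfm hr1.1.le ht.1 (by linarith [ht.2])
            simp only [hN]
            gcongr
            exact ht.1
        _ = _ := by
            rw [← lintegral_indicator measurableSet_Icc]
            refine lintegral_congr fun t => ?_
            simp [hF, hS, indicator]
    calc _ = ENNReal.ofReal (1 - r)⁻¹ * N r * radialMeasure ω (Icc r 1) := by
          simp only [hN]; ring
      _ ≤ ENNReal.ofReal (1 - r)⁻¹ * N r * (ENNReal.ofReal (C₂ / (C₂ - 1)) *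
          radialMeasure ω (Icc r (1 - (1 - r) / K))) := by gcongr
      _ = ENNReal.ofReal (C₂ / (C₂ - 1)) * (ENNReal.ofReal (1 - r)⁻¹ * N r *
          radialMeasure ω (Icc r (1 - (1 - r) / K))) := by ring
      _ ≤ _ := by gcongr
  have hTm := measurable_radialMeasure_Icc ω
  calc ∫⁻ z in disc, ENNReal.ofReal (tail ω ‖z‖ / (1 - ‖z‖)) * ‖f z‖ₑ ^ p
      = ∫⁻ z in disc, radialMeasure ω (Icc ‖z‖ 1) * ENNReal.ofReal (1 - ‖z‖)⁻¹ * g z := by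
        refine setLIntegral_congr_fun measurableSet_ball fun z hz => ?_
        have hz1 : ‖z‖ < 1 := by simpa using hz
        simp only [hg]
        rw [hr.radialMeasure_Icc_one (norm_nonneg z) hz1.le, div_eq_mul_inv,
          ENNReal.ofReal_mul (hr.tail_nonneg (norm_nonneg z) hz1.le)]
    _ = ∫⁻ r in Ioo 0 1, ENNReal.ofReal r * (radialMeasure ω (Icc r 1) *
          ENNReal.ofReal (1 - r)⁻¹ * circleMass g r) := by
        rw [setLIntegral_ball_polar]
        · refine setLIntegral_congr_fun measurableSet_Ioo fun r hr1 => ?_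
          rw [circleMass_radial (fun r => radialMeasure ω (Icc r 1) * ENNReal.ofReal (1 - r)⁻¹)
            (fun t => ENNReal.mul_ne_top (measure_ne_top _ _) ENNReal.ofReal_ne_top) g hr1.1.le]
        · exact ((hTm.comp measurable_norm).mul (by fun_prop)).mul hgm
    _ ≤ ∫⁻ r in Ioo 0 1, ENNReal.ofReal (C₂ / (C₂ - 1)) * ∫⁻ t, F r t ∂radialMeasure ω :=
        setLIntegral_mono' measurableSet_Ioo hpt
    _ = ENNReal.ofReal (C₂ / (C₂ - 1)) * ∫⁻ t, (∫⁻ r in Ioo 0 1, F r t) ∂radialMeasure ω := by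
        rw [lintegral_const_mul' _ _ ENNReal.ofReal_ne_top,
          lintegral_lintegral_swap hFm.aemeasurable]
    _ ≤ ENNReal.ofReal (C₂ / (C₂ - 1)) *
          ∫⁻ t, ENNReal.ofReal (K - 1) * N t ∂radialMeasure ω := by
        gcongr ENNReal.ofReal (C₂ / (C₂ - 1)) * ?_
        refine lintegral_mono_ae ?_
        filter_upwards [ae_radialMeasure_mem ω] with t ht
        calc ∫⁻ r in Ioo 0 1, F r t
            = ∫⁻ r in Ioo 0 1, {r | r ≤ t ∧ t ≤ 1 - (1 - r) / K}.indicator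
                (fun r => ENNReal.ofReal (1 - r)⁻¹) r * N t := by
              refine lintegral_congr fun r => ?_
              simp only [hF, hS, indicator, mem_ofPred_eq, ite_mul, zero_mul]
          _ ≤ _ := by
              rw [lintegral_mul_const]
              · gcongr
                exact lintegral_inv_one_sub_le hK ht.2
              · have h : Measurable fun r : ℝ => ENNReal.ofReal (1 - r)⁻¹ := by fun_prop
                refine h.indicator ?_
                exact (measurableSet_le measurable_id measurable_const).inter
                  (measurableSet_le measurable_const
                    (show Measurable fun r : ℝ => 1 - (1 - r) / K by fun_prop))
    _ = _ := by
        rw [hr.lintegral_weightMeasure hgm, lintegral_const_mul' _ _ ENNReal.ofReal_ne_top,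
          ENNReal.ofReal_mul (mul_nonneg hc.le (by linarith)), ENNReal.ofReal_mul hc.le]
        rw [mul_assoc, mul_assoc]
        congr 2
        rw [← lintegral_const_mul' _ _ ENNReal.ofReal_ne_top]
        refine lintegral_congr fun t => ?_
        rw [← mul_assoc, ← ENNReal.ofReal_mul hπ.le, mul_div_cancel₀ _ hπ.ne']

theorem squareSize_pos (hω0 : ∀ r ∈ Ico (0 : ℝ) 1, 0 < tail ω r) {r : ℝ} (hr : 0 ≤ r)
    (hr1 : r < 1) : 0 < squareSize ω r :=
  mul_pos (by linarith) (hω0 r ⟨hr, hr1⟩)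

/-- The bound for point evaluations on the Bergman space: the sub-mean value property over a disc
of radius comparable to `1 - |z|`, on which the regularized weight is essentially constant. -/
theorem IsTwoSidedDoubling.exists_pointwise_le (hω : IsTwoSidedDoubling ω) {p : ℝ} (hp : 1 ≤ p) :
    ∃ C : ℝ, 0 < C ∧ ∀ f : ℂ → ℂ, DifferentiableOn ℂ f disc → Measurable f → ∀ z ∈ disc,
      ENNReal.ofReal (squareSize ω ‖z‖) * ‖f z‖ₑ ^ p ≤
        ENNReal.ofReal C * ∫⁻ z, ‖f z‖ₑ ^ p ∂weightMeasure ω := by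
  have hr := hω.toIsRadialWeight
  obtain ⟨C₁, hC₁, hup⟩ := hω.upper
  obtain ⟨A, hA, hAf⟩ := hω.exists_lintegral_tail_le hp
  have hπ := Real.pi_pos
  have hC0 : 0 < C₁ := by linarith
  refine ⟨4 / Real.pi * (3 / 2 * C₁) * A, by positivity, fun f hf hfm z hz => ?_⟩
  have hz1 : ‖z‖ < 1 := by simpa using hz
  have hz0 := norm_nonneg z
  set u := 1 - ‖z‖ with hu
  have hu0 : 0 < u := by linarith
  have htz := hr.tail_nonneg hz0 hz1.le
  have hsub : Metric.ball z (u / 2) ⊆ disc := by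
    refine Metric.ball_subset_ball' ?_
    rw [dist_zero_right]
    linarith
  have h1 := enorm_rpow_le_setLIntegral_ball hp (half_pos hu0) (hf.mono hsub) hfm
  have h2 : ENNReal.ofReal (tail ω ‖z‖ / u) * ∫⁻ w in Metric.ball z (u / 2), ‖f w‖ₑ ^ p ≤
      ENNReal.ofReal (3 / 2 * C₁) *
        ∫⁻ w in disc, ENNReal.ofReal (tail ω ‖w‖ / (1 - ‖w‖)) * ‖f w‖ₑ ^ p := by
    rw [← lintegral_const_mul' _ _ ENNReal.ofReal_ne_top,
      ← lintegral_const_mul' _ _ ENNReal.ofReal_ne_top]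
    refine le_trans (setLIntegral_mono' measurableSet_ball fun w hw => ?_) (lintegral_mono_set hsub)
    rw [← mul_assoc, ← ENNReal.ofReal_mul (by positivity)]
    gcongr
    have hw' : ‖w - z‖ < u / 2 := by simpa [dist_eq_norm] using hw
    have h3 : ‖w‖ ≤ ‖z‖ + ‖w - z‖ := by simpa using norm_add_le z (w - z)
    have h4 : ‖z‖ ≤ ‖w‖ + ‖w - z‖ := by
      have := norm_sub_le w (w - z)
      simpa using this
    have h5 : tail ω ((‖z‖ + 1) / 2) ≤ tail ω ‖w‖ :=
      hr.tail_anti (norm_nonneg w) (by linarith) (by linarith)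
    have h6 := hup ‖z‖ ⟨hz0, hz1⟩
    have h7 : 0 < 1 - ‖w‖ := by linarith
    have h8 : 1 - ‖w‖ ≤ 3 / 2 * u := by linarith
    have h9 : tail ω ‖z‖ ≤ C₁ * tail ω ‖w‖ := h6.trans (by gcongr)
    rw [mul_div_assoc', div_le_div_iff₀ hu0 h7]
    calc tail ω ‖z‖ * (1 - ‖w‖) ≤ (C₁ * tail ω ‖w‖) * (3 / 2 * u) := by
          refine mul_le_mul h9 h8 h7.le (htz.trans h9)
      _ = _ := by ring
  calc ENNReal.ofReal (squareSize ω ‖z‖) * ‖f z‖ₑ ^ p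
      ≤ ENNReal.ofReal (squareSize ω ‖z‖) * (ENNReal.ofReal (1 / (Real.pi * (u / 2) ^ 2)) *
        ∫⁻ w in Metric.ball z (u / 2), ‖f w‖ₑ ^ p) := by gcongr
    _ = ENNReal.ofReal (4 / Real.pi) * (ENNReal.ofReal (tail ω ‖z‖ / u) *
        ∫⁻ w in Metric.ball z (u / 2), ‖f w‖ₑ ^ p) := by
        rw [← mul_assoc, ← mul_assoc,
          ← ENNReal.ofReal_mul (show 0 ≤ squareSize ω ‖z‖ from mul_nonneg hu0.le htz),
          ← ENNReal.ofReal_mul (by positivity)]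
        congr 2
        rw [squareSize, ← hu]
        field_simp
        norm_num
    _ ≤ ENNReal.ofReal (4 / Real.pi) * (ENNReal.ofReal (3 / 2 * C₁) *
        (ENNReal.ofReal A * ∫⁻ z, ‖f z‖ₑ ^ p ∂weightMeasure ω)) := by
        grw [h2, hAf f hf hfm]
    _ = _ := by
        rw [← mul_assoc, ← mul_assoc, ← ENNReal.ofReal_mul (by positivity),
          ← ENNReal.ofReal_mul (by positivity)]

/-! ### The Carleson embedding near the boundary -/

theorem ball_subset_pseudoDisc {s : ℝ} {z w : ℂ} (hs0 : 0 < s) (hs1 : s < 1) (hz : z ∈ disc)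
    (hw : w ∈ Metric.ball z (s / 2 * (1 - ‖z‖))) : z ∈ pseudoDisc s w := by
  have hz1 : ‖z‖ < 1 := by simpa using hz
  have hw' : ‖w - z‖ < s / 2 * (1 - ‖z‖) := by simpa [dist_eq_norm] using hw
  have h3 : ‖w‖ ≤ ‖z‖ + ‖w - z‖ := by simpa using norm_add_le z (w - z)
  have hw1 : ‖w‖ < 1 := by nlinarith
  refine ⟨hz, ?_⟩
  have h : 1 - ‖z‖ ≤ ‖1 - (starRingEnd ℂ) w * z‖ := by
    have h4 := norm_sub_norm_le (1 : ℂ) ((starRingEnd ℂ) w * z)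
    rw [norm_one, norm_mul, RCLike.norm_conj] at h4
    nlinarith [norm_nonneg z]
  rw [norm_div, div_lt_iff₀ (by linarith)]
  nlinarith

/-- If the `μ`-measures of the pseudohyperbolic discs near the circle are small relative to the
Carleson squares, then so is the `L^q(μ)` norm of `f^(n)` near the circle. The derivative at `z` is
bounded by the mean of `|f|^q` over a disc about `z`, Fubini's theorem turns the integral against
`μ` into one against `μ(E_s(w)) |f(w)|^q`, and the pointwise bound reduces `|f|^q` to `|f|^p`. -/
theorem IsTwoSidedDoubling.exists_embedding (hω : IsTwoSidedDoubling ω) {p q : ℝ} (hp : 1 ≤ p)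
    (hpq : p ≤ q) (n : ℕ) {s : ℝ} (hs0 : 0 < s) (hs1 : s < 1) :
    ∃ C : ℝ, 0 < C ∧ ∀ (μ : Measure ℂ), IsFiniteMeasure (μ.restrict disc) →
      ∀ (M : ℝ≥0∞) (R : ℝ), M ≠ ∞ →
      (∀ w ∈ disc, R < ‖w‖ → μ (pseudoDisc s w) ≤
        M * (ENNReal.ofReal (1 - ‖w‖) ^ (n * q) * ENNReal.ofReal (squareSize ω ‖w‖) ^ (q / p))) →
      ∀ f : ℂ → ℂ, DifferentiableOn ℂ f disc → Measurable f →
        ∫⁻ z, ‖f z‖ₑ ^ p ∂weightMeasure ω ≠ ∞ →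
        ∫⁻ z in {z | (2 * R + 1) / 3 < ‖z‖}, ‖iteratedDeriv n f z‖ₑ ^ q ∂μ.restrict disc ≤
          ENNReal.ofReal C * M * (∫⁻ z, ‖f z‖ₑ ^ p ∂weightMeasure ω) ^ (q / p) := by
  have hr := hω.toIsRadialWeight
  obtain ⟨A, hA, hAf⟩ := hω.exists_lintegral_tail_le hp
  obtain ⟨B, hB, hBf⟩ := hω.exists_pointwise_le hp
  have hπ := Real.pi_pos
  have hp0 : 0 < p := by linarith
  have hq0 : 0 < q := by linarith
  have hqp : 0 ≤ q / p - 1 := by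
    rw [sub_nonneg, one_le_div hp0]
    exact hpq
  -- `κ t` is the constant in the estimate of the derivative by the mean over a disc of radius
  -- `s t / 2`; it is used for `t = 1 - |z|`.
  set κ : ℝ → ℝ := fun t => ((n.factorial : ℝ) * (2 / (s / 2 * t)) ^ n) ^ q *
    (4 / (Real.pi * (s / 2 * t) ^ 2)) with hκ
  set L : ℝ := ((n.factorial : ℝ) * (6 / s) ^ n) ^ q * (36 / (Real.pi * s ^ 2)) with hL
  have hL0 : 0 < L := by positivity
  have hκL : ∀ u : ℝ, 0 < u → κ (2 / 3 * u) * u ^ (n * q) = L / u ^ 2 := by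
    intro u hu
    have h1 : (n.factorial : ℝ) * (2 / (s / 2 * (2 / 3 * u))) ^ n =
        (n.factorial * (6 / s) ^ n) * (u⁻¹) ^ n := by
      rw [mul_assoc, ← mul_pow]
      congr 2
      field_simp
      norm_num
    have h2 : ((u⁻¹) ^ n : ℝ) ^ q * u ^ (n * q) = 1 := by
      rw [inv_pow, Real.inv_rpow (by positivity), ← Real.rpow_natCast u n, ← Real.rpow_mul hu.le,
        inv_mul_cancel₀ (by positivity)]
    simp only [hκ, hL]
    rw [h1, Real.mul_rpow (by positivity) (by positivity)]
    calc _ = ((n.factorial : ℝ) * (6 / s) ^ n) ^ q * (((u⁻¹) ^ n : ℝ) ^ q * u ^ (n * q)) *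
          (4 / (Real.pi * (s / 2 * (2 / 3 * u)) ^ 2)) := by ring
      _ = _ := by
        rw [h2]
        field_simp
        norm_num
  refine ⟨L * B ^ (q / p - 1) * A, by positivity, fun μ hμ M R hMt hM f hf hfm hIt => ?_⟩
  set I := ∫⁻ z, ‖f z‖ₑ ^ p ∂weightMeasure ω with hI
  set E : Set ℂ := {z | (2 * R + 1) / 3 < ‖z‖} with hE
  have hEm : MeasurableSet E := measurableSet_lt measurable_const measurable_norm
  set ν : Measure ℂ := (μ.restrict disc).restrict E with hν
  set S : Set (ℂ × ℂ) := {x | x.2 ∈ Metric.ball x.1 (s / 2 * (1 - ‖x.1‖))} with hS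
  have hSm : MeasurableSet S := by
    have h : MeasurableSet {x : ℂ × ℂ | dist x.2 x.1 < s / 2 * (1 - ‖x.1‖)} :=
      measurableSet_lt (by fun_prop) (by fun_prop)
    exact h
  set Φ : ℂ → ℝ≥0∞ := fun w => ENNReal.ofReal (κ (2 / 3 * (1 - ‖w‖))) * ‖f w‖ₑ ^ q with hΦ
  have hΦm : Measurable Φ := by
    simp only [hΦ, hκ]
    fun_prop
  set F : ℂ → ℂ → ℝ≥0∞ := fun z w => S.indicator (fun x => Φ x.2) (z, w) with hF
  have hFm : Measurable (Function.uncurry F) := (hΦm.comp measurable_snd).indicator hSm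
  have hνmem : ∀ᵐ z ∂ν, z ∈ disc ∧ (2 * R + 1) / 3 < ‖z‖ := by
    filter_upwards [ae_restrict_mem hEm, Measure.restrict_le_self.absolutelyContinuous.ae_le
      (ae_restrict_mem (μ := μ) (s := disc) measurableSet_ball)] with z h1 h2 using ⟨h2, h1⟩
  -- The discs about points with `|z| > (2 R + 1) / 3` stay in `|w| > R`.
  have hgeom : ∀ z w : ℂ, w ∈ Metric.ball z (s / 2 * (1 - ‖z‖)) → z ∈ disc →
      ‖w‖ < 1 ∧ (3 * ‖z‖ - 1) / 2 ≤ ‖w‖ ∧ 2 / 3 * (1 - ‖w‖) ≤ 1 - ‖z‖ := by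
    intro z w hw hz
    have hz1 : ‖z‖ < 1 := by simpa using hz
    have hw' : ‖w - z‖ < s / 2 * (1 - ‖z‖) := by simpa [dist_eq_norm] using hw
    have h3 : ‖w‖ ≤ ‖z‖ + ‖w - z‖ := by simpa using norm_add_le z (w - z)
    have h4 : ‖z‖ ≤ ‖w‖ + ‖w - z‖ := by simpa using norm_sub_le w (w - z)
    refine ⟨by nlinarith, by nlinarith, by nlinarith⟩
  have h1 : ∫⁻ z, ‖iteratedDeriv n f z‖ₑ ^ q ∂ν ≤ ∫⁻ z, (∫⁻ w, F z w) ∂ν := by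
    refine lintegral_mono_ae ?_
    filter_upwards [hνmem] with z hz
    have hz1 : ‖z‖ < 1 := by simpa using hz.1
    have hρ : 0 < s / 2 * (1 - ‖z‖) := by
      have : 0 < 1 - ‖z‖ := by linarith
      positivity
    have hsub : Metric.ball z (s / 2 * (1 - ‖z‖)) ⊆ disc := fun w hw => by
      simpa using (hgeom z w hw hz.1).1
    calc _ ≤ _ := enorm_iteratedDeriv_rpow_le n (hp.trans hpq) hρ (hf.mono hsub) hfm
      _ = ∫⁻ w in Metric.ball z (s / 2 * (1 - ‖z‖)),
          ENNReal.ofReal (κ (1 - ‖z‖)) * ‖f w‖ₑ ^ q := by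
          rw [lintegral_const_mul' _ _ ENNReal.ofReal_ne_top]
      _ ≤ ∫⁻ w in Metric.ball z (s / 2 * (1 - ‖z‖)), Φ w := by
          refine setLIntegral_mono' measurableSet_ball fun w hw => ?_
          obtain ⟨g1, -, g3⟩ := hgeom z w hw hz.1
          have g4 : 0 < 1 - ‖w‖ := by linarith
          simp only [hΦ, hκ]
          gcongr
      _ = _ := by
          rw [← lintegral_indicator measurableSet_ball]
          rfl
  have h2 : ∀ w, ∫⁻ z, F z w ∂ν ≤ disc.indicator (fun w => ENNReal.ofReal
      (L * B ^ (q / p - 1)) * M * I ^ (q / p - 1) *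
        (ENNReal.ofReal (tail ω ‖w‖ / (1 - ‖w‖)) * ‖f w‖ₑ ^ p)) w := by
    intro w
    by_cases hw : w ∈ disc ∧ R < ‖w‖
    · have hw1 : ‖w‖ < 1 := by simpa using hw.1
      have hu : 0 < 1 - ‖w‖ := by linarith
      have htw := hr.tail_nonneg (norm_nonneg w) hw1.le
      have hsq : 0 ≤ squareSize ω ‖w‖ := mul_nonneg hu.le htw
      rw [indicator_of_mem hw.1]
      have h3 : ∫⁻ z, F z w ∂ν ≤ Φ w * μ (pseudoDisc s w) := by
        calc ∫⁻ z, F z w ∂ν ≤ ∫⁻ z, ({z | (z, w) ∈ S} ∩ disc).indicator (fun _ => Φ w) z ∂ν := by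
              refine lintegral_mono_ae ?_
              filter_upwards [hνmem] with z hz
              simp only [hF, indicator]
              by_cases hzw : (z, w) ∈ S
              · simp [hzw, show z ∈ disc from hz.1]
              · simp [hzw]
          _ = Φ w * ν ({z | (z, w) ∈ S} ∩ disc) := by
              have : MeasurableSet {z | (z, w) ∈ S} := measurable_prodMk_right hSm
              rw [lintegral_indicator (this.inter measurableSet_ball), setLIntegral_const]
          _ ≤ _ := by
              gcongr Φ w * ?_
              calc ν ({z | (z, w) ∈ S} ∩ disc) ≤ μ ({z | (z, w) ∈ S} ∩ disc) :=
                    (Measure.restrict_le_self.trans Measure.restrict_le_self) _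
                _ ≤ _ := measure_mono fun z hz => ball_subset_pseudoDisc hs0 hs1 hz.2 hz.1
      have h4 : ‖f w‖ₑ ^ q * ENNReal.ofReal (squareSize ω ‖w‖) ^ (q / p) ≤
          ENNReal.ofReal (B ^ (q / p - 1)) * I ^ (q / p - 1) *
          (ENNReal.ofReal (squareSize ω ‖w‖) * ‖f w‖ₑ ^ p) := by
        set X := ENNReal.ofReal (squareSize ω ‖w‖) * ‖f w‖ₑ ^ p with hX
        have e : ‖f w‖ₑ ^ q * ENNReal.ofReal (squareSize ω ‖w‖) ^ (q / p) = X ^ (q / p) := by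
          rw [hX, ENNReal.mul_rpow_of_nonneg _ _ (by positivity), ← ENNReal.rpow_mul,
            mul_div_cancel₀ q hp0.ne', mul_comm]
        have e2 : X ^ (q / p) = X ^ (q / p - 1) * X := by
          rw [← ENNReal.rpow_one X, ← ENNReal.rpow_mul, ← ENNReal.rpow_mul,
            ← ENNReal.rpow_add_of_nonneg _ _ (by simpa using hqp) (by norm_num)]
          congr 1
          ring
        rw [e, e2]
        gcongr
        rw [← ENNReal.ofReal_rpow_of_pos hB, ← ENNReal.mul_rpow_of_nonneg _ _ hqp]
        exact ENNReal.rpow_le_rpow (hBf f hf hfm w hw.1) hqp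
      calc ∫⁻ z, F z w ∂ν ≤ Φ w * (M * (ENNReal.ofReal (1 - ‖w‖) ^ (n * q) *
            ENNReal.ofReal (squareSize ω ‖w‖) ^ (q / p))) :=
            h3.trans (by gcongr; exact hM w hw.1 hw.2)
        _ = M * (ENNReal.ofReal (κ (2 / 3 * (1 - ‖w‖))) * ENNReal.ofReal (1 - ‖w‖) ^ (n * q)) *
            (‖f w‖ₑ ^ q * ENNReal.ofReal (squareSize ω ‖w‖) ^ (q / p)) := by
            simp only [hΦ]; ring
        _ ≤ M * ENNReal.ofReal (L / (1 - ‖w‖) ^ 2) *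
            (ENNReal.ofReal (B ^ (q / p - 1)) * I ^ (q / p - 1) *
            (ENNReal.ofReal (squareSize ω ‖w‖) * ‖f w‖ₑ ^ p)) := by
            rw [ENNReal.ofReal_rpow_of_pos hu, ← ENNReal.ofReal_mul (by positivity), hκL _ hu]
            gcongr
        _ = M * I ^ (q / p - 1) * ‖f w‖ₑ ^ p * (ENNReal.ofReal (L / (1 - ‖w‖) ^ 2) *
            ENNReal.ofReal (B ^ (q / p - 1)) * ENNReal.ofReal (squareSize ω ‖w‖)) := by ring
        _ = M * I ^ (q / p - 1) * ‖f w‖ₑ ^ p * (ENNReal.ofReal (L * B ^ (q / p - 1)) *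
            ENNReal.ofReal (tail ω ‖w‖ / (1 - ‖w‖))) := by
            rw [← ENNReal.ofReal_mul (by positivity), ← ENNReal.ofReal_mul (by positivity),
              ← ENNReal.ofReal_mul (by positivity), squareSize]
            congr 2
            field_simp
        _ = _ := by ring
    · refine le_of_eq_of_le ?_ zero_le
      refine (lintegral_congr_ae ?_).trans lintegral_zero
      filter_upwards [hνmem] with z hz
      simp only [hF]
      refine indicator_of_notMem (fun hzw => hw ?_) _
      obtain ⟨g1, g2, -⟩ := hgeom z w hzw hz.1
      exact ⟨by simpa using g1, by linarith [hz.2]⟩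
  calc ∫⁻ z, ‖iteratedDeriv n f z‖ₑ ^ q ∂ν ≤ ∫⁻ w, (∫⁻ z, F z w ∂ν) := by
        rw [← lintegral_lintegral_swap hFm.aemeasurable]
        exact h1
    _ ≤ _ := lintegral_mono h2
    _ ≤ ENNReal.ofReal (L * B ^ (q / p - 1)) * M * I ^ (q / p - 1) * (ENNReal.ofReal A * I) := by
        rw [lintegral_indicator measurableSet_ball, lintegral_const_mul']
        · gcongr
          exact hAf f hf hfm
        · exact ENNReal.mul_ne_top (ENNReal.mul_ne_top ENNReal.ofReal_ne_top hMt)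
            (ENNReal.rpow_ne_top_of_nonneg hqp hIt)
    _ = _ := by
        have e : I ^ (q / p) = I ^ (q / p - 1) * I := by
          nth_rewrite 3 [← ENNReal.rpow_one I]
          rw [← ENNReal.rpow_add_of_nonneg _ _ hqp (by norm_num), sub_add_cancel]
        rw [e, ENNReal.ofReal_mul (p := L * B ^ (q / p - 1)) (by positivity)]
        ring

variable {p q : ℝ≥0∞}

/-! ### Elements of the Bergman space -/

theorem Bergman.measurable (f : Bergman p ω) : Measurable f.toFun := by
  have h : f.toFun = disc.indicator f.toFun := by
    refine (indicator_eq_self.2 fun z hz => ?_).symm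
    by_contra hzd
    exact hz ((Subtype.property f).2.1 z hzd)
  classical
  rw [h, ← piecewise_eq_indicator]
  exact f.differentiableOn.continuousOn.measurable_piecewise continuousOn_const measurableSet_ball

/-- The element of the Bergman space given by a function on the plane that is holomorphic and
`p`-integrable on the disc. -/
def Bergman.ofFun (f : ℂ → ℂ) (hf : DifferentiableOn ℂ f disc) (hp : MemLp f p (weightMeasure ω)) :
    Bergman p ω :=
  ⟨disc.indicator f, hf.congr fun _ hz => indicator_of_mem hz f,
    fun _ hz => indicator_of_notMem hz f, hp.indicator measurableSet_ball⟩

theorem Bergman.toFun_ofFun (f : ℂ → ℂ) (hf : DifferentiableOn ℂ f disc)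
    (hp : MemLp f p (weightMeasure ω)) : (Bergman.ofFun f hf hp).toFun = disc.indicator f := rfl

theorem Bergman.iteratedDeriv_ofFun {f : ℂ → ℂ} (hf : DifferentiableOn ℂ f disc)
    (hp : MemLp f p (weightMeasure ω)) (n : ℕ) {z : ℂ} (hz : z ∈ disc) :
    iteratedDeriv n (Bergman.ofFun f hf hp).toFun z = iteratedDeriv n f z := by
  refine Filter.EventuallyEq.iteratedDeriv_eq n ?_
  filter_upwards [Metric.isOpen_ball.mem_nhds hz] with w hw
  rw [Bergman.toFun_ofFun, indicator_of_mem hw]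

theorem Bergman.ofFun_ae_eq {f : ℂ → ℂ} (hf : DifferentiableOn ℂ f disc)
    (hp : MemLp f p (weightMeasure ω)) :
    (Bergman.ofFun f hf hp).toFun =ᵐ[weightMeasure ω] f := by
  filter_upwards [ae_weightMeasure_mem_disc ω] with z hz
  rw [Bergman.toFun_ofFun, indicator_of_mem hz]

theorem Bergman.enorm_def [Fact (1 ≤ p)] (f : Bergman p ω) :
    ‖f‖ₑ = eLpNorm f.toFun p (weightMeasure ω) := by
  rw [← ofReal_norm, Bergman.norm_def, ENNReal.ofReal_toReal f.memLp.2.ne]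

theorem eLpNorm_rpow_toReal {α : Type*} {m : MeasurableSpace α} {μ : Measure α} (hp0 : p ≠ 0)
    (hp : p ≠ ∞) (f : α → ℂ) : eLpNorm f p μ ^ p.toReal = ∫⁻ x, ‖f x‖ₑ ^ p.toReal ∂μ := by
  have h : 0 < p.toReal := ENNReal.toReal_pos hp0 hp
  rw [eLpNorm_eq_lintegral_rpow_enorm_toReal hp0 hp, ← ENNReal.rpow_mul, one_div_mul_cancel h.ne',
    ENNReal.rpow_one]

theorem Bergman.lintegral_eq [Fact (1 ≤ p)] (hp0 : p ≠ 0) (hp : p ≠ ∞) (f : Bergman p ω) :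
    ∫⁻ z, ‖f.toFun z‖ₑ ^ p.toReal ∂weightMeasure ω = ‖f‖ₑ ^ p.toReal := by
  rw [Bergman.enorm_def, eLpNorm_rpow_toReal hp0 hp]

theorem one_le_toReal (hp1 : 1 ≤ p) (hp : p ≠ ∞) : 1 ≤ p.toReal := by
  simpa using ENNReal.toReal_mono hp hp1

theorem IsTwoSidedDoubling.exists_norm_le [hp1 : Fact (1 ≤ p)] (hω : IsTwoSidedDoubling ω)
    (hω0 : ∀ r ∈ Ico (0 : ℝ) 1, 0 < tail ω r) (hp : p ≠ ∞) {ρ : ℝ} (hρ0 : 0 ≤ ρ) (hρ : ρ < 1) :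
    ∃ S : ℝ, 0 < S ∧ ∀ (f : Bergman p ω) (z : ℂ), ‖z‖ ≤ ρ → ‖f.toFun z‖ ≤ S * ‖f‖ := by
  have hP := one_le_toReal hp1.out hp
  have hP0 : 0 < p.toReal := by linarith
  obtain ⟨C, hC, hCf⟩ := hω.exists_pointwise_le hP
  have hs := squareSize_pos hω0 hρ0 hρ
  refine ⟨(C / squareSize ω ρ) ^ (1 / p.toReal), by positivity, fun f z hz => ?_⟩
  have hz1 : ‖z‖ < 1 := hz.trans_lt hρ
  have h := hCf f.toFun f.differentiableOn f.measurable z (by simpa using hz1)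
  rw [f.lintegral_eq (zero_lt_one.trans_le hp1.out).ne' hp, ← ofReal_norm, ← ofReal_norm,
    ENNReal.ofReal_rpow_of_nonneg (norm_nonneg _) hP0.le,
    ENNReal.ofReal_rpow_of_nonneg (norm_nonneg _) hP0.le,
    ← ENNReal.ofReal_mul (squareSize_pos hω0 (norm_nonneg z) hz1).le, ← ENNReal.ofReal_mul hC.le,
    ENNReal.ofReal_le_ofReal_iff (by positivity)] at h
  have hmono : squareSize ω ρ ≤ squareSize ω ‖z‖ := by
    unfold squareSize
    have h1 := hω.tail_anti (norm_nonneg z) hz hρ.le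
    have h2 := hω.tail_nonneg hρ0 hρ.le
    nlinarith
  have h3 : ‖f.toFun z‖ ^ p.toReal ≤ C / squareSize ω ρ * ‖f‖ ^ p.toReal := by
    rw [div_mul_eq_mul_div, le_div_iff₀ hs, mul_comm]
    exact (mul_le_mul_of_nonneg_right hmono (by positivity)).trans h
  have h4 := Real.rpow_le_rpow (by positivity) h3 (show 0 ≤ 1 / p.toReal by positivity)
  rwa [Real.mul_rpow (by positivity) (by positivity), ← Real.rpow_mul (norm_nonneg _),
    ← Real.rpow_mul (norm_nonneg _), mul_one_div_cancel hP0.ne', Real.rpow_one,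
    Real.rpow_one] at h4

/-- Testing the operator on the monomial `z^n`, whose `n`-th derivative is constant, shows that `μ`
is finite on the disc. -/
theorem DiffBounded.isFiniteMeasure {n : ℕ} {μ : Measure ℂ} (hω : IsRadialWeight ω)
    (hq0 : q ≠ 0) (hq : q ≠ ∞) (h : DiffBounded p q ω n μ) : IsFiniteMeasure (μ.restrict disc) := by
  have := hω.isFiniteMeasure_weightMeasure
  have hd : Differentiable ℂ fun z : ℂ => z ^ n := by fun_prop
  have hmem : MemLp (fun z : ℂ => z ^ n) p (weightMeasure ω) := by
    refine MemLp.of_bound hd.continuous.aestronglyMeasurable 1 ?_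
    filter_upwards [ae_weightMeasure_mem_disc ω] with z hz
    rw [norm_pow]
    exact pow_le_one₀ (norm_nonneg z) (by simpa using (Metric.mem_ball.1 hz).le)
  have h1 := h.memLp (Bergman.ofFun _ hd.differentiableOn hmem)
  set c : ℂ := ∏ i ∈ Finset.range n, ((n : ℂ) - i) with hc
  have hc0 : c ≠ 0 := by
    refine Finset.prod_ne_zero_iff.2 fun i hi => sub_ne_zero.2 ?_
    exact_mod_cast (Finset.mem_range.1 hi).ne'
  have h2 : MemLp (fun _ : ℂ => c) q (μ.restrict disc) := by
    refine h1.ae_eq ?_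
    filter_upwards [ae_restrict_mem measurableSet_ball] with z hz
    rw [Bergman.iteratedDeriv_ofFun _ _ n hz, iteratedDeriv_eq_iterate, iter_deriv_pow]
    simp [hc]
  exact ⟨((memLp_const_iff hq0 hq).1 h2).resolve_left hc0⟩

/-! ### Approximation of `f^(n)` on compact subsets by operators of finite rank -/

theorem Bergman.differentiableOn_iteratedDeriv (f : Bergman p ω) (n : ℕ) :
    DifferentiableOn ℂ (iteratedDeriv n f.toFun) disc := by
  rw [iteratedDeriv_eq_iterate]
  exact ((f.differentiableOn.analyticOnNhd Metric.isOpen_ball).iterated_deriv n).differentiableOn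

theorem iteratedDeriv_iteratedDeriv_eq (k n : ℕ) (f : ℂ → ℂ) :
    iteratedDeriv k (iteratedDeriv n f) = iteratedDeriv (k + n) f := by
  simp only [iteratedDeriv_eq_iterate, Function.iterate_add_apply]

theorem IsTwoSidedDoubling.exists_norm_iteratedDeriv_le [hp1 : Fact (1 ≤ p)]
    (hω : IsTwoSidedDoubling ω) (hω0 : ∀ r ∈ Ico (0 : ℝ) 1, 0 < tail ω r) (hp : p ≠ ∞) (n : ℕ)
    {ρ : ℝ} (hρ0 : 0 ≤ ρ) (hρ : ρ < 1) :
    ∃ S : ℝ, 0 < S ∧ ∀ (f : Bergman p ω) (z : ℂ), ‖z‖ ≤ ρ →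
      ‖iteratedDeriv n f.toFun z‖ ≤ S * ‖f‖ := by
  obtain ⟨S, hS, hSf⟩ := hω.exists_norm_le (p := p) hω0 hp (ρ := (1 + ρ) / 2) (by linarith)
    (by linarith)
  have hδ : 0 < (1 - ρ) / 2 := by linarith
  refine ⟨n.factorial * S / ((1 - ρ) / 2) ^ n, by positivity, fun f z hz => ?_⟩
  have hball : Metric.closedBall z ((1 - ρ) / 2) ⊆ Metric.closedBall 0 ((1 + ρ) / 2) := by
    refine Metric.closedBall_subset_closedBall' ?_
    rw [dist_zero_right]
    linarith
  have hd : DiffContOnCl ℂ f.toFun (Metric.ball z ((1 - ρ) / 2)) := by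
    refine DifferentiableOn.diffContOnCl ?_
    rw [closure_ball _ hδ.ne']
    exact f.differentiableOn.mono
      (hball.trans (Metric.closedBall_subset_ball (by linarith)))
  refine (Complex.norm_iteratedDeriv_le_of_forall_mem_sphere_norm_le n hδ hd
    (C := S * ‖f‖) fun w hw => hSf f w ?_).trans_eq (by ring)
  simpa using hball (Metric.sphere_subset_closedBall hw)

/-- The `k`-th Taylor coefficient of `f^(n)` at the origin, as a functional on the Bergman
space. -/
def taylorCoeff [hp1 : Fact (1 ≤ p)] (hω : IsTwoSidedDoubling ω)
    (hω0 : ∀ r ∈ Ico (0 : ℝ) 1, 0 < tail ω r) (hp : p ≠ ∞) (n k : ℕ) : Bergman p ω →L[ℂ] ℂ :=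
  LinearMap.mkContinuousOfExistsBound
    { toFun := fun f => (k.factorial : ℂ)⁻¹ * iteratedDeriv k (iteratedDeriv n f.toFun) 0
      map_add' := fun f g => by
        have h0 : (0 : ℂ) ∈ disc := by simp
        rw [iteratedDeriv_iteratedDeriv_eq, iteratedDeriv_iteratedDeriv_eq,
          iteratedDeriv_iteratedDeriv_eq, Bergman.toFun_add,
          iteratedDeriv_add (f.contDiffAt _ h0) (g.contDiffAt _ h0), mul_add]
      map_smul' := fun c f => by
        have h0 : (0 : ℂ) ∈ disc := by simp
        rw [iteratedDeriv_iteratedDeriv_eq, iteratedDeriv_iteratedDeriv_eq,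
          Bergman.toFun_smul, iteratedDeriv_const_smul (f.contDiffAt _ h0) c, RingHom.id_apply,
          smul_eq_mul, smul_eq_mul, mul_left_comm] } <| by
    obtain ⟨S, -, hSf⟩ := hω.exists_norm_iteratedDeriv_le (p := p) hω0 hp (k + n) le_rfl one_pos
    refine ⟨‖(k.factorial : ℂ)⁻¹‖ * S, fun f => ?_⟩
    have := hSf f 0 (by simp)
    simp only [LinearMap.coe_mk, AddHom.coe_mk]
    rw [norm_mul, mul_assoc, iteratedDeriv_iteratedDeriv_eq]
    gcongr

theorem taylorCoeff_apply [hp1 : Fact (1 ≤ p)] (hω : IsTwoSidedDoubling ω)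
    (hω0 : ∀ r ∈ Ico (0 : ℝ) 1, 0 < tail ω r) (hp : p ≠ ∞) (n k : ℕ) (f : Bergman p ω) :
    taylorCoeff hω hω0 hp n k f =
      (k.factorial : ℂ)⁻¹ * iteratedDeriv k (iteratedDeriv n f.toFun) 0 := rfl

/-- The Taylor polynomials of `f^(n)` converge on `|z| ≤ R` uniformly over the unit ball of the
Bergman space. -/
theorem exists_taylor_bound [hp1 : Fact (1 ≤ p)] (hω : IsTwoSidedDoubling ω)
    (hω0 : ∀ r ∈ Ico (0 : ℝ) 1, 0 < tail ω r) (hp : p ≠ ∞) (n : ℕ) {R : ℝ} (hR0 : 0 ≤ R)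
    (hR : R < 1) {ε : ℝ} (hε : 0 < ε) :
    ∃ N : ℕ, ∀ (f : Bergman p ω) (z : ℂ), ‖z‖ ≤ R →
      ‖iteratedDeriv n f.toFun z - ∑ k : Fin N, taylorCoeff hω hω0 hp n k f * z ^ (k : ℕ)‖ ≤
        ε * ‖f‖ := by
  set ρ := (1 + R) / 2 with hρ
  have hρ0 : 0 < ρ := by linarith
  have hρ1 : ρ < 1 := by linarith
  have hRρ : R < ρ := by linarith
  clear_value ρ
  obtain ⟨S, hS, hSf⟩ := hω.exists_norm_iteratedDeriv_le (p := p) hω0 hp n hρ0.le hρ1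
  have hx0 : 0 ≤ R / ρ := by positivity
  have hx1 : R / ρ < 1 := (div_lt_one hρ0).2 hRρ
  have hlim : Tendsto (fun N : ℕ => S * (R / ρ) ^ N / (1 - R / ρ)) atTop (𝓝 0) := by
    simpa using ((tendsto_pow_atTop_nhds_zero_of_lt_one hx0 hx1).const_mul S).div_const
      (1 - R / ρ)
  obtain ⟨N, hN⟩ := (hlim.eventually (gt_mem_nhds hε)).exists
  refine ⟨N, fun f z hz => ?_⟩
  set h := iteratedDeriv n f.toFun with hh
  have hdiff := f.differentiableOn_iteratedDeriv n
  have hd : DiffContOnCl ℂ h (Metric.ball 0 ρ) := by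
    refine DifferentiableOn.diffContOnCl ?_
    rw [closure_ball _ hρ0.ne']
    exact hdiff.mono (Metric.closedBall_subset_ball hρ1)
  have hsum := Complex.hasSum_taylorSeries_on_ball (f := h) (c := 0) (r := 1) (z := z) hdiff
    (by simpa using hz.trans_lt hR)
  have hterm : ∀ k : ℕ, ‖((k.factorial : ℂ)⁻¹ • (z - 0) ^ k • iteratedDeriv k h 0)‖ ≤
      (S * ‖f‖) * (R / ρ) ^ k := by
    intro k
    have h1 := Complex.norm_iteratedDeriv_le_of_forall_mem_sphere_norm_le k hρ0 hd
      (C := S * ‖f‖) fun w hw => hSf f w (by simpa using (mem_sphere_iff_norm.1 hw).le)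
    have hk : (0 : ℝ) < k.factorial := by positivity
    rw [sub_zero, norm_smul, norm_smul, norm_inv, Complex.norm_natCast, norm_pow]
    calc (k.factorial : ℝ)⁻¹ * (‖z‖ ^ k * ‖iteratedDeriv k h 0‖)
        ≤ (k.factorial : ℝ)⁻¹ * (R ^ k * (k.factorial * (S * ‖f‖) / ρ ^ k)) := by gcongr
      _ = _ := by
        rw [div_pow]
        field_simp
  have hb := norm_sub_le_of_geometric_bound_of_hasSum hx1 hterm hsum N
  rw [norm_sub_rev] at hb
  have he : ∑ k : Fin N, taylorCoeff hω hω0 hp n k f * z ^ (k : ℕ) =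
      ∑ k ∈ Finset.range N, ((k.factorial : ℂ)⁻¹ • (z - 0) ^ k • iteratedDeriv k h 0) := by
    rw [Finset.sum_range]
    refine Finset.sum_congr rfl fun k _ => ?_
    rw [taylorCoeff_apply, sub_zero, smul_eq_mul, smul_eq_mul]
    ring
  rw [he]
  refine hb.trans ?_
  calc S * ‖f‖ * (R / ρ) ^ N / (1 - R / ρ) = S * (R / ρ) ^ N / (1 - R / ρ) * ‖f‖ := by ring
    _ ≤ ε * ‖f‖ := by gcongr

theorem essNorm_le {X Y : Type*} [SeminormedAddCommGroup X] [NormedSpace ℂ X]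
    [SeminormedAddCommGroup Y] [NormedSpace ℂ Y] (T K : X →L[ℂ] Y) (hK : IsCompactOperator K) :
    essNorm T ≤ ‖T - K‖ :=
  csInf_le ⟨0, by rintro t ⟨K, -, rfl⟩; exact norm_nonneg _⟩ ⟨K, hK, rfl⟩

theorem essNorm_nonneg {X Y : Type*} [SeminormedAddCommGroup X] [NormedSpace ℂ X]
    [SeminormedAddCommGroup Y] [NormedSpace ℂ Y] (T : X →L[ℂ] Y) : 0 ≤ essNorm T :=
  Real.sInf_nonneg (by rintro t ⟨K, -, rfl⟩; exact norm_nonneg _)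

theorem memLp_truncatedPolynomial (q : ℝ≥0∞) (ν : Measure ℂ) [IsFiniteMeasure ν] (R : ℝ) (N : ℕ)
    (v : Fin N → ℂ) : MemLp ((Metric.closedBall (0 : ℂ) R).indicator
      fun z => ∑ k, v k * z ^ (k : ℕ)) q ν := by
  have hc : Continuous fun z : ℂ => ∑ k, v k * z ^ (k : ℕ) := by fun_prop
  obtain ⟨C, hC⟩ := (isCompact_closedBall (0 : ℂ) R).exists_bound_of_continuousOn hc.continuousOn
  refine MemLp.of_bound (hc.aestronglyMeasurable.indicator measurableSet_closedBall) (max C 0)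
    (Eventually.of_forall fun z => ?_)
  by_cases hz : z ∈ Metric.closedBall (0 : ℂ) R
  · rw [indicator_of_mem hz]
    exact (hC z hz).trans (le_max_left _ _)
  · rw [indicator_of_notMem hz, norm_zero]
    exact le_max_right _ _

/-- The operator `v ↦ 1_{|z| ≤ R} ∑ v_k z^k` from `ℂ^N` to `L^q(ν)`. -/
def truncatedPolynomial (q : ℝ≥0∞) (ν : Measure ℂ) [IsFiniteMeasure ν] (R : ℝ) (N : ℕ) :
    (Fin N → ℂ) →ₗ[ℂ] Lp ℂ q ν where
  toFun v := (memLp_truncatedPolynomial q ν R N v).toLp _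
  map_add' v w := by
    rw [← MemLp.toLp_add]
    refine MemLp.toLp_congr _ _ (Eventually.of_forall fun z => ?_)
    simp only [indicator, Pi.add_apply, add_mul, Finset.sum_add_distrib]
    split_ifs <;> simp
  map_smul' c v := by
    rw [RingHom.id_apply, ← MemLp.toLp_const_smul]
    refine MemLp.toLp_congr _ _ (Eventually.of_forall fun z => ?_)
    simp only [indicator, Pi.smul_apply, smul_eq_mul, mul_assoc]
    split_ifs <;> simp [Finset.mul_sum]

theorem coeFn_truncatedPolynomial (q : ℝ≥0∞) (ν : Measure ℂ) [IsFiniteMeasure ν] (R : ℝ) (N : ℕ)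
    (v : Fin N → ℂ) : truncatedPolynomial q ν R N v =ᵐ[ν]
      (Metric.closedBall (0 : ℂ) R).indicator fun z => ∑ k, v k * z ^ (k : ℕ) :=
  MemLp.coeFn_toLp (memLp_truncatedPolynomial q ν R N v)

/-- Only the behaviour of `f^(n)` near the circle contributes to the essential norm: on `|z| ≤ R`
the operator is, up to a small error, the finite rank operator that takes `f` to a Taylor
polynomial of `f^(n)`. -/
theorem DiffBounded.essNorm_le_of_tail [hp1 : Fact (1 ≤ p)] [hq1 : Fact (1 ≤ q)] {n : ℕ}
    {μ : Measure ℂ} (hω : IsTwoSidedDoubling ω) (hω0 : ∀ r ∈ Ico (0 : ℝ) 1, 0 < tail ω r)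
    (hp : p ≠ ∞) (hq : q ≠ ∞) (hμ : DiffBounded p q ω n μ) {R D : ℝ} (hR0 : 0 ≤ R) (hR : R < 1)
    (hD : 0 ≤ D) (h : ∀ f : Bergman p ω, eLpNorm (iteratedDeriv n f.toFun) q
      ((μ.restrict disc).restrict {z | R < ‖z‖}) ≤ ENNReal.ofReal (D * ‖f‖)) :
    essNorm hμ.operator ≤ D := by
  have hq0 : q ≠ 0 := (zero_lt_one.trans_le hq1.out).ne'
  have hfin := hμ.isFiniteMeasure hω.toIsRadialWeight hq0 hq
  set ν := μ.restrict disc with hν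
  set m : ℝ := (ν univ ^ (1 / q.toReal)).toReal with hm
  have hmt : ν univ ^ (1 / q.toReal) ≠ ∞ :=
    ENNReal.rpow_ne_top_of_nonneg (by positivity) (measure_ne_top _ _)
  have hm0 : 0 ≤ m := ENNReal.toReal_nonneg
  refine le_of_forall_pos_le_add fun ε hε => ?_
  obtain ⟨N, hN⟩ := exists_taylor_bound (p := p) hω hω0 hp n hR0 hR
    (show 0 < ε / (m + 1) by positivity)
  set b : Bergman p ω →L[ℂ] (Fin N → ℂ) :=
    ContinuousLinearMap.pi fun k => taylorCoeff hω hω0 hp n k with hb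
  set Φ : (Fin N → ℂ) →L[ℂ] Lp ℂ q ν :=
    LinearMap.toContinuousLinearMap (truncatedPolynomial q ν R N) with hΦ
  have hK : IsCompactOperator (Φ.comp b) :=
    (isCompactOperator_of_locallyCompactSpace_dom b).clm_comp Φ
  refine (essNorm_le _ _ hK).trans (ContinuousLinearMap.opNorm_le_bound _ (by positivity)
    fun f => ?_)
  set g := iteratedDeriv n f.toFun with hg
  set P : ℂ → ℂ := fun z => ∑ k : Fin N, taylorCoeff hω hω0 hp n k f * z ^ (k : ℕ) with hP
  have hgm : AEStronglyMeasurable g ν := f.aestronglyMeasurable_iteratedDeriv n μ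
  have hPc : Continuous P := by fun_prop
  have hEm : MeasurableSet {z : ℂ | R < ‖z‖} := measurableSet_lt measurable_const measurable_norm
  have hae : (hμ.operator - Φ.comp b) f =ᵐ[ν] {z : ℂ | R < ‖z‖}.indicator g +
      (Metric.closedBall (0 : ℂ) R).indicator (g - P) := by
    have h1 : hμ.operator f =ᵐ[ν] g := MemLp.coeFn_toLp (hμ.memLp f)
    have h2 : Φ (b f) =ᵐ[ν] (Metric.closedBall (0 : ℂ) R).indicator P :=
      coeFn_truncatedPolynomial q ν R N (b f)
    rw [sub_apply, ContinuousLinearMap.comp_apply]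
    filter_upwards [Lp.coeFn_sub (hμ.operator f) (Φ (b f)), h1, h2] with z e1 e2 e3
    rw [e1, Pi.sub_apply, e2, e3, Pi.add_apply]
    by_cases hz : R < ‖z‖
    · have hz' : z ∉ Metric.closedBall (0 : ℂ) R := by simpa using hz
      rw [indicator_of_mem (show z ∈ {z : ℂ | R < ‖z‖} from hz), indicator_of_notMem hz',
        indicator_of_notMem hz', sub_zero, add_zero]
    · have hz' : z ∈ Metric.closedBall (0 : ℂ) R := by simpa using hz
      rw [indicator_of_notMem (show z ∉ {z : ℂ | R < ‖z‖} from hz), indicator_of_mem hz',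
        indicator_of_mem hz', zero_add, Pi.sub_apply]
  have hsmall : eLpNorm ((Metric.closedBall (0 : ℂ) R).indicator (g - P)) q ν ≤
      ENNReal.ofReal (ε * ‖f‖) := by
    have hb1 : ∀ᵐ z ∂ν, ‖(Metric.closedBall (0 : ℂ) R).indicator (g - P) z‖ ≤
        ε / (m + 1) * ‖f‖ := Eventually.of_forall fun z => by
      by_cases hz : z ∈ Metric.closedBall (0 : ℂ) R
      · rw [indicator_of_mem hz]
        exact hN f z (by simpa using hz)
      · rw [indicator_of_notMem hz, norm_zero]
        positivity
    refine (eLpNorm_le_of_ae_bound hb1).trans ?_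
    rw [← one_div, ← ENNReal.ofReal_toReal hmt, ← hm, ← ENNReal.ofReal_mul hm0]
    refine ENNReal.ofReal_le_ofReal ?_
    calc m * (ε / (m + 1) * ‖f‖) = m / (m + 1) * (ε * ‖f‖) := by ring
      _ ≤ 1 * (ε * ‖f‖) := by
        gcongr
        rw [div_le_one (by positivity)]
        linarith
      _ = _ := one_mul _
  have hnorm : ‖(hμ.operator - Φ.comp b) f‖ₑ ≤ ENNReal.ofReal ((D + ε) * ‖f‖) := by
    rw [Lp.enorm_def, eLpNorm_congr_ae hae, add_mul, ENNReal.ofReal_add (by positivity)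
      (by positivity)]
    refine (eLpNorm_add_le (hgm.indicator hEm)
      ((hgm.sub hPc.aestronglyMeasurable).indicator measurableSet_closedBall) hq1.out).trans ?_
    gcongr
    rw [eLpNorm_indicator_eq_eLpNorm_restrict hEm]
    exact h f
  rw [← ofReal_norm, ENNReal.ofReal_le_ofReal_iff (by positivity)] at hnorm
  exact hnorm

/-! ### Test functions -/

/-- The radial integral of a high power of the kernel `(1 - a) / (1 - a r)` is controlled by the
tail at `a`. The proof passes from `a` to `2 a - 1`: below `a` this multiplies the kernel by at
least `4 / 3`, and it multiplies the tail by at most the doubling constant. -/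
theorem lintegral_radial_kernel_le (hω : IsRadialWeight ω) {C₁ σ : ℝ} (hC₁ : 1 ≤ C₁)
    (hup : ∀ r ∈ Ico (0 : ℝ) 1, tail ω r ≤ C₁ * tail ω ((r + 1) / 2)) (hσ0 : 0 ≤ σ)
    (hσ : (3 / 4 : ℝ) ^ σ * C₁ ≤ 1 / 2) {a : ℝ} (ha0 : 0 ≤ a) (ha1 : a < 1) :
    ∫⁻ r, ENNReal.ofReal (((1 - a) / (1 - a * r)) ^ σ) ∂radialMeasure ω ≤
      ENNReal.ofReal (2 * C₁ * tail ω a) := by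
  have hbase : ∀ a : ℝ, 0 ≤ a → a ≤ 1 / 2 →
      ∫⁻ r, ENNReal.ofReal (((1 - a) / (1 - a * r)) ^ σ) ∂radialMeasure ω ≤
      ENNReal.ofReal (2 * C₁ * tail ω a) := by
    intro a ha0 ha
    calc _ ≤ ∫⁻ _, 1 ∂radialMeasure ω := by
          refine lintegral_mono_ae ?_
          filter_upwards [ae_radialMeasure_mem ω] with r hr
          rw [← ENNReal.ofReal_one]
          have h1 : 0 < 1 - a * r := by nlinarith [hr.1, hr.2]
          refine ENNReal.ofReal_le_ofReal (Real.rpow_le_one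
            (div_nonneg (by linarith) h1.le) ?_ hσ0)
          rw [div_le_one h1]
          nlinarith [hr.1, hr.2]
      _ = ENNReal.ofReal (tail ω 0) := by rw [lintegral_one, hω.radialMeasure_univ]
      _ ≤ _ := by
          refine ENNReal.ofReal_le_ofReal ?_
          have h0 := hup 0 ⟨le_rfl, one_pos⟩
          have h1 : tail ω ((0 + 1) / 2) ≤ tail ω a :=
            hω.tail_anti ha0 (by linarith) (by norm_num)
          have h2 := hω.tail_nonneg ha0 (by linarith : a ≤ 1)
          nlinarith
  have key : ∀ k : ℕ, ∀ a : ℝ, 0 ≤ a → a < 1 → (1 / 2 : ℝ) ^ (k + 1) ≤ 1 - a →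
      ∫⁻ r, ENNReal.ofReal (((1 - a) / (1 - a * r)) ^ σ) ∂radialMeasure ω ≤
      ENNReal.ofReal (2 * C₁ * tail ω a) := by
    intro k
    induction k with
    | zero =>
      intro a ha0 _ hk
      exact hbase a ha0 (by norm_num at hk; linarith)
    | succ k ih =>
      intro a ha0 ha1 hk
      rcases le_or_gt a (1 / 2) with ha | ha
      · exact hbase a ha0 ha
      have hih := ih (2 * a - 1) (by linarith) (by linarith) (by rw [pow_succ] at hk; linarith)
      have hta := hω.tail_nonneg ha0 ha1.le
      have ht' : tail ω (2 * a - 1) ≤ C₁ * tail ω a := by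
        have := hup (2 * a - 1) ⟨by linarith, by linarith⟩
        rwa [show (2 * a - 1 + 1) / 2 = a by ring] at this
      calc _ ≤ ∫⁻ r, ((Icc a 1).indicator 1 r + ENNReal.ofReal ((3 / 4 : ℝ) ^ σ) *
            ENNReal.ofReal (((1 - (2 * a - 1)) / (1 - (2 * a - 1) * r)) ^ σ))
              ∂radialMeasure ω := by
            refine lintegral_mono_ae ?_
            filter_upwards [ae_radialMeasure_mem ω] with r hr
            have h1 : 0 < 1 - a * r := by nlinarith [hr.1, hr.2]
            have h2 : 0 < 1 - (2 * a - 1) * r := by nlinarith [hr.1, hr.2]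
            have h3 : 0 ≤ (1 - a) / (1 - a * r) := div_nonneg (by linarith) h1.le
            rcases le_or_gt a r with har | har
            · rw [indicator_of_mem (show r ∈ Icc a 1 from ⟨har, hr.2.le⟩)]
              refine le_add_right ?_
              rw [Pi.one_apply, ← ENNReal.ofReal_one]
              refine ENNReal.ofReal_le_ofReal (Real.rpow_le_one h3 ?_ hσ0)
              rw [div_le_one h1]
              nlinarith [hr.1, hr.2]
            · refine le_add_left ?_
              rw [← ENNReal.ofReal_mul (by positivity), ← Real.mul_rpow (by norm_num)
                (div_nonneg (by linarith) h2.le)]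
              refine ENNReal.ofReal_le_ofReal (Real.rpow_le_rpow h3 ?_ hσ0)
              rw [mul_div_assoc', div_le_div_iff₀ h1 h2]
              have h4 : r * (1 - a / 2) ≤ 1 / 2 := by nlinarith [sq_nonneg (1 - a)]
              nlinarith
        _ = ENNReal.ofReal (tail ω a) + ENNReal.ofReal ((3 / 4 : ℝ) ^ σ) *
            ∫⁻ r, ENNReal.ofReal (((1 - (2 * a - 1)) / (1 - (2 * a - 1) * r)) ^ σ)
              ∂radialMeasure ω := by
            rw [lintegral_add_left (measurable_one.indicator measurableSet_Icc),
              lintegral_indicator_one measurableSet_Icc, hω.radialMeasure_Icc_one ha0 ha1.le,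
              lintegral_const_mul' _ _ ENNReal.ofReal_ne_top]
        _ ≤ ENNReal.ofReal (tail ω a) + ENNReal.ofReal ((3 / 4 : ℝ) ^ σ) *
            ENNReal.ofReal (2 * C₁ * tail ω (2 * a - 1)) := by gcongr
        _ ≤ _ := by
            rw [← ENNReal.ofReal_mul (by positivity), ← ENNReal.ofReal_add hta (by
              have := hω.tail_nonneg (a := 2 * a - 1) (by linarith) (by linarith)
              positivity)]
            refine ENNReal.ofReal_le_ofReal ?_
            calc tail ω a + (3 / 4 : ℝ) ^ σ * (2 * C₁ * tail ω (2 * a - 1))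
                ≤ tail ω a + (3 / 4 : ℝ) ^ σ * (2 * C₁ * (C₁ * tail ω a)) := by gcongr
              _ = tail ω a + ((3 / 4 : ℝ) ^ σ * C₁) * (2 * C₁ * tail ω a) := by ring
              _ ≤ tail ω a + 1 / 2 * (2 * C₁ * tail ω a) := by gcongr
              _ ≤ _ := by nlinarith
  obtain ⟨k, hk⟩ := exists_pow_lt_of_lt_one (show 0 < 1 - a by linarith)
    (show (1 / 2 : ℝ) < 1 by norm_num)
  refine key k a ha0 ha1 (le_trans ?_ hk.le)
  exact pow_le_pow_of_le_one (by norm_num) (by norm_num) (Nat.le_succ k)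

/-- The tails of a doubling weight decay at most like a power of `1 - a`. -/
theorem rpow_mul_tail_zero_le (hω : IsRadialWeight ω) {C₁ σ : ℝ} (hC₁ : 1 ≤ C₁)
    (hup : ∀ r ∈ Ico (0 : ℝ) 1, tail ω r ≤ C₁ * tail ω ((r + 1) / 2)) (hσ0 : 0 ≤ σ)
    (hσ : (3 / 4 : ℝ) ^ σ * C₁ ≤ 1 / 2) {a : ℝ} (ha0 : 0 ≤ a) (ha1 : a < 1) :
    (1 - a) ^ σ * tail ω 0 ≤ 2 * C₁ * tail ω a := by
  have hta := hω.tail_nonneg ha0 ha1.le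
  rw [← ENNReal.ofReal_le_ofReal_iff (by positivity)]
  refine le_trans ?_ (lintegral_radial_kernel_le hω hC₁ hup hσ0 hσ ha0 ha1)
  have h1a : 0 < 1 - a := by linarith
  rw [ENNReal.ofReal_mul (by positivity), ← hω.radialMeasure_univ, ← lintegral_const]
  refine lintegral_mono_ae ?_
  filter_upwards [ae_radialMeasure_mem ω] with r hr
  refine ENNReal.ofReal_le_ofReal (Real.rpow_le_rpow h1a.le ?_ hσ0)
  have h1 : 0 < 1 - a * r := by nlinarith [hr.1, hr.2]
  rw [le_div_iff₀ h1]
  nlinarith [mul_nonneg ha0 hr.1.le]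

theorem one_sub_le_norm_one_sub_conj_mul {a z : ℂ} {r : ℝ} (hz : ‖z‖ ≤ r) :
    1 - ‖a‖ * r ≤ ‖1 - (starRingEnd ℂ) a * z‖ := by
  have h := norm_sub_norm_le (1 : ℂ) ((starRingEnd ℂ) a * z)
  rw [norm_one, norm_mul, RCLike.norm_conj] at h
  nlinarith [mul_le_mul_of_nonneg_left hz (norm_nonneg a)]

/-- The area integral of a high power of `(1 - |a|) / |1 - conj a * z|`: integrating the second
power over circles leaves the radial integral of the remaining power. -/
theorem lintegral_kernel_le (hω : IsRadialWeight ω) {C₁ γ : ℝ} (hC₁ : 1 ≤ C₁)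
    (hup : ∀ r ∈ Ico (0 : ℝ) 1, tail ω r ≤ C₁ * tail ω ((r + 1) / 2)) (hγ2 : 2 ≤ γ)
    (hγ : (3 / 4 : ℝ) ^ (γ - 1) * C₁ ≤ 1 / 2) {a : ℂ} (ha : ‖a‖ < 1) :
    ∫⁻ z, ENNReal.ofReal (((1 - ‖a‖) / ‖1 - (starRingEnd ℂ) a * z‖) ^ γ) ∂weightMeasure ω ≤
      ENNReal.ofReal (4 * C₁ * squareSize ω ‖a‖) := by
  have hπ := Real.pi_pos
  have ha0 := norm_nonneg a
  have h1a : 0 < 1 - ‖a‖ := by linarith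
  rw [hω.lintegral_weightMeasure (by fun_prop)]
  calc _ ≤ ∫⁻ r, ENNReal.ofReal (2 * (1 - ‖a‖)) *
        ENNReal.ofReal (((1 - ‖a‖) / (1 - ‖a‖ * r)) ^ (γ - 1)) ∂radialMeasure ω := by
        refine lintegral_mono_ae ?_
        filter_upwards [ae_radialMeasure_mem ω] with r hr
        have har : ‖a‖ * r < 1 := by nlinarith [hr.1, hr.2]
        have har0 : 0 ≤ ‖a‖ * r := mul_nonneg ha0 hr.1.le
        have hd : 0 < 1 - ‖a‖ * r := by linarith
        have hpt : ∀ θ, ENNReal.ofReal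
            (((1 - ‖a‖) / ‖1 - (starRingEnd ℂ) a * circleMap 0 r θ‖) ^ γ) ≤
            ENNReal.ofReal ((1 - ‖a‖) ^ γ * (1 - ‖a‖ * r) ^ (2 - γ)) *
              ENNReal.ofReal (‖1 - (starRingEnd ℂ) a * circleMap 0 r θ‖ ^ 2)⁻¹ := by
          intro θ
          have h := one_sub_le_norm_one_sub_conj_mul (a := a) (z := circleMap 0 r θ) (r := r)
            (by simp [abs_of_pos hr.1])
          set X := ‖1 - (starRingEnd ℂ) a * circleMap 0 r θ‖ with hX
          have hX0 : 0 < X := hd.trans_le h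
          rw [← ENNReal.ofReal_mul (by positivity)]
          refine ENNReal.ofReal_le_ofReal ?_
          rw [Real.div_rpow h1a.le hX0.le, div_eq_mul_inv, mul_assoc]
          gcongr
          calc (X ^ γ)⁻¹ = X ^ (2 - γ) * (X ^ 2)⁻¹ := by
                rw [← Real.rpow_neg hX0.le, ← Real.rpow_natCast, ← Real.rpow_neg hX0.le,
                  ← Real.rpow_add hX0]
                congr 1
                push_cast
                ring
            _ ≤ (1 - ‖a‖ * r) ^ (2 - γ) * (X ^ 2)⁻¹ :=
                mul_le_mul_of_nonneg_right
                  (Real.rpow_le_rpow_of_nonpos hd h (by linarith)) (by positivity)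
        calc _ ≤ ENNReal.ofReal (r / Real.pi) * (ENNReal.ofReal ((1 - ‖a‖) ^ γ *
              (1 - ‖a‖ * r) ^ (2 - γ)) * circleMass
                (fun z => ENNReal.ofReal (‖1 - (starRingEnd ℂ) a * z‖ ^ 2)⁻¹) r) := by
              gcongr
              rw [← circleMass_const_mul _ ENNReal.ofReal_ne_top]
              exact lintegral_mono hpt
          _ ≤ _ := by
              rw [lintegral_circle_inv_sq hr.1.le har, ← ENNReal.ofReal_mul (by positivity),
                ← ENNReal.ofReal_mul (div_nonneg hr.1.le hπ.le),
                ← ENNReal.ofReal_mul (by positivity)]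
              refine ENNReal.ofReal_le_ofReal ?_
              set d := 1 - ‖a‖ * r with hdd
              have e1 : (1 - ‖a‖) ^ γ = (1 - ‖a‖) ^ (γ - 1) * (1 - ‖a‖) := by
                rw [← Real.rpow_add_one h1a.ne', sub_add_cancel]
              have e2 : d ^ (2 - γ) = (d ^ (γ - 1))⁻¹ * d := by
                rw [← Real.rpow_neg hd.le, ← Real.rpow_add_one hd.ne']
                congr 1
                ring
              have h4 : d ≤ 1 - (‖a‖ * r) ^ 2 := by nlinarith
              have h5 : d / (1 - (‖a‖ * r) ^ 2) ≤ 1 := (div_le_one (hd.trans_le h4)).2 h4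
              have h6 : 0 < 1 - (‖a‖ * r) ^ 2 := hd.trans_le h4
              rw [Real.div_rpow h1a.le hd.le, e1, e2]
              calc _ = 2 * (1 - ‖a‖) * ((1 - ‖a‖) ^ (γ - 1) / d ^ (γ - 1)) *
                    (r * (d / (1 - (‖a‖ * r) ^ 2))) := by
                    field_simp
                _ ≤ 2 * (1 - ‖a‖) * ((1 - ‖a‖) ^ (γ - 1) / d ^ (γ - 1)) * (1 * 1) := by
                    have := hr.2.le
                    gcongr
                _ = _ := by ring
    _ ≤ ENNReal.ofReal (2 * (1 - ‖a‖)) * ENNReal.ofReal (2 * C₁ * tail ω ‖a‖) := by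
        rw [lintegral_const_mul' _ _ ENNReal.ofReal_ne_top]
        gcongr
        exact lintegral_radial_kernel_le hω hC₁ hup (by linarith) hγ ha0 ha
    _ = _ := by
        rw [← ENNReal.ofReal_mul (by positivity), squareSize]
        congr 1
        ring

theorem iteratedDeriv_inv_pow_kernel {b : ℂ} (hb : ‖b‖ < 1) (m n : ℕ) :
    ∀ z ∈ disc, iteratedDeriv n (fun z => ((1 - b * z) ^ m)⁻¹) z =
      (m.ascFactorial n : ℂ) * b ^ n * ((1 - b * z) ^ (m + n))⁻¹ := by
  induction n with
  | zero => intro z _; simp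
  | succ n ih =>
    intro z hz
    have hne : 1 - b * z ≠ 0 := by
      have h := one_sub_le_norm_one_sub_conj_mul (a := (starRingEnd ℂ) b) (z := z) le_rfl
      rw [RCLike.norm_conj, Complex.conj_conj] at h
      have hz1 : ‖z‖ < 1 := by simpa using hz
      refine norm_pos_iff.1 (lt_of_lt_of_le ?_ h)
      nlinarith [norm_nonneg b, norm_nonneg z]
    have heq : iteratedDeriv n (fun z => ((1 - b * z) ^ m)⁻¹) =ᶠ[𝓝 z]
        fun z => (m.ascFactorial n : ℂ) * b ^ n * ((1 - b * z) ^ (m + n))⁻¹ := by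
      filter_upwards [Metric.isOpen_ball.mem_nhds hz] with w hw using ih w hw
    have hd : HasDerivAt (fun z => (1 - b * z) ^ (m + n))
        ((m + n : ℕ) * (1 - b * z) ^ (m + n - 1) * (-b)) z := by
      have h1 : HasDerivAt (fun z : ℂ => 1 - b * z) (-b) z := by
        simpa using ((hasDerivAt_id z).const_mul b).const_sub 1
      exact h1.pow (m + n)
    have hd' : HasDerivAt (fun z => (m.ascFactorial n : ℂ) * b ^ n * ((1 - b * z) ^ (m + n))⁻¹)
        _ z := (hd.inv (pow_ne_zero _ hne)).const_mul _
    rw [iteratedDeriv_succ, heq.deriv_eq, hd'.deriv, Nat.ascFactorial_succ]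
    rcases Nat.eq_zero_or_pos (m + n) with h0 | h0
    · simp [h0]
    · obtain ⟨k, hk⟩ : ∃ k, m + n = k + 1 := ⟨m + n - 1, by omega⟩
      rw [← add_assoc, hk]
      simp only [Nat.add_sub_cancel]
      push_cast
      field_simp
      ring

theorem norm_one_sub_le_of_mem_pseudoDisc {s : ℝ} (hs1 : s < 1) {a z : ℂ} (ha : ‖a‖ < 1)
    (hz : z ∈ pseudoDisc s a) :
    ‖1 - (starRingEnd ℂ) a * z‖ ≤ 2 * (1 - ‖a‖) / (1 - s) := by
  have hz1 : ‖z‖ ≤ 1 := by simpa using (Metric.mem_ball.1 hz.1).le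
  have hpos : 0 < ‖1 - (starRingEnd ℂ) a * z‖ := by
    have := one_sub_le_norm_one_sub_conj_mul (a := a) hz1
    linarith
  have h := hz.2
  rw [norm_div, div_lt_iff₀ hpos] at h
  have e : 1 - (starRingEnd ℂ) a * z =
      (1 - (starRingEnd ℂ) a * a) + (starRingEnd ℂ) a * (a - z) := by
    ring
  have h1 : ‖1 - (starRingEnd ℂ) a * a‖ = 1 - ‖a‖ ^ 2 := by
    rw [Complex.conj_mul', ← Complex.ofReal_pow, ← Complex.ofReal_one, ← Complex.ofReal_sub,
      Complex.norm_real, Real.norm_of_nonneg]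
    nlinarith [norm_nonneg a]
  have h2 : ‖1 - (starRingEnd ℂ) a * z‖ ≤ (1 - ‖a‖ ^ 2) + ‖a‖ * ‖a - z‖ := by
    conv_lhs => rw [e]
    refine (norm_add_le _ _).trans ?_
    rw [h1, norm_mul, RCLike.norm_conj]
  rw [le_div_iff₀ (by linarith)]
  nlinarith [norm_nonneg a, norm_nonneg (a - z)]

/-- Functions with bounded norm in the Bergman space that are small on compact sets when `a` is near
the circle, and whose `n`-th derivatives are large on the pseudohyperbolic disc at `a`: normalized
powers of `(1 - |a|) / (1 - conj a * z)`. -/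
theorem IsTwoSidedDoubling.exists_testFunctions [hp1 : Fact (1 ≤ p)] (hω : IsTwoSidedDoubling ω)
    (hω0 : ∀ r ∈ Ico (0 : ℝ) 1, 0 < tail ω r) (hp : p ≠ ∞) (n : ℕ) {s : ℝ} (hs1 : s < 1) :
    ∃ B c : ℝ, 0 < B ∧ 0 < c ∧ ∃ D : ℝ → ℝ, ∀ a ∈ disc, ∃ f : Bergman p ω, ‖f‖ ≤ B ∧
      (∀ R < 1, ∀ z, ‖z‖ ≤ R → ‖f.toFun z‖ ^ p.toReal ≤ D R * (1 - ‖a‖)) ∧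
      (1 / 2 ≤ ‖a‖ → ∀ z ∈ pseudoDisc s a,
        c * ((1 - ‖a‖) ^ n)⁻¹ * (squareSize ω ‖a‖ ^ (1 / p.toReal))⁻¹ ≤
          ‖iteratedDeriv n f.toFun z‖) := by
  have hr := hω.toIsRadialWeight
  have := hr.isFiniteMeasure_weightMeasure
  obtain ⟨C₁, hC₁, hup⟩ := hω.upper
  have hP := one_le_toReal hp1.out hp
  have hp0 : p ≠ 0 := (zero_lt_one.trans_le hp1.out).ne'
  set P := p.toReal with hPdef
  have hP0 : 0 < P := by linarith
  have hC0 : 0 < C₁ := by linarith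
  have ht0 := hω0 0 ⟨le_rfl, one_pos⟩
  -- The exponent `m P - 1` serves the norm estimate. On compact sets `m P - 2` is needed, since
  -- one factor `1 - |a|` is absorbed by `squareSize` and another has to remain.
  obtain ⟨m, hm2, hm⟩ : ∃ m : ℕ, 2 ≤ m ∧ (3 / 4 : ℝ) ^ ((m : ℝ) * P - 2) * C₁ ≤ 1 / 2 := by
    obtain ⟨k, hk⟩ := exists_pow_lt_of_lt_one (show 0 < 1 / (2 * C₁) by positivity)
      (show (3 / 4 : ℝ) < 1 by norm_num)
    refine ⟨k + 2, by omega, ?_⟩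
    have h1 : (3 / 4 : ℝ) ^ (((k + 2 : ℕ) : ℝ) * P - 2) ≤ (3 / 4 : ℝ) ^ (k : ℝ) := by
      refine Real.rpow_le_rpow_of_exponent_ge (by norm_num) (by norm_num) ?_
      push_cast
      nlinarith [Nat.cast_nonneg (α := ℝ) k]
    rw [Real.rpow_natCast] at h1
    calc _ ≤ 1 / (2 * C₁) * C₁ := by
          gcongr
          exact h1.trans hk.le
      _ = 1 / 2 := by field_simp
  have hm2' : (2 : ℝ) ≤ m := by exact_mod_cast hm2
  have hγ2 : 2 ≤ (m : ℝ) * P := by nlinarith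
  have hγ1 : (3 / 4 : ℝ) ^ ((m : ℝ) * P - 1) * C₁ ≤ 1 / 2 := by
    refine le_trans ?_ hm
    gcongr ?_ * C₁
    exact Real.rpow_le_rpow_of_exponent_ge (by norm_num) (by norm_num) (by linarith)
  refine ⟨(4 * C₁) ^ (1 / P), (1 / 2) ^ n * ((1 - s) / 2) ^ (m + n), by positivity,
    mul_pos (by positivity) (pow_pos (by linarith) _),
    fun R => 2 * C₁ / tail ω 0 * ((1 - R) ^ ((m : ℝ) * P))⁻¹, fun a ha => ?_⟩
  have ha1 : ‖a‖ < 1 := by simpa using ha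
  have ha0 := norm_nonneg a
  have h1a : 0 < 1 - ‖a‖ := by linarith
  have hsq := squareSize_pos hω0 ha0 ha1
  set b := (starRingEnd ℂ) a with hb
  have hbn : ‖b‖ = ‖a‖ := RCLike.norm_conj a
  have hlow : ∀ z ∈ disc, 1 - ‖a‖ ≤ ‖1 - b * z‖ := fun z hz => by
    have hz1 : ‖z‖ ≤ 1 := by simpa using (Metric.mem_ball.1 hz).le
    simpa using one_sub_le_norm_one_sub_conj_mul (a := a) hz1
  have hne : ∀ z ∈ disc, 1 - b * z ≠ 0 := fun z hz =>
    norm_pos_iff.1 (h1a.trans_le (hlow z hz))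
  set t : ℝ := (squareSize ω ‖a‖ ^ (1 / P))⁻¹ * (1 - ‖a‖) ^ m with ht
  have ht0' : 0 < t := by positivity
  set g : ℂ → ℂ := fun z => ((1 - b * z) ^ m)⁻¹ with hg
  set F : ℂ → ℂ := (t : ℂ) • g with hF
  have hgd : DifferentiableOn ℂ g disc := fun z hz => by
    have h1 : DifferentiableAt ℂ (fun z => (1 - b * z) ^ m) z := by fun_prop
    exact (h1.inv (pow_ne_zero _ (hne z hz))).differentiableWithinAt
  have hFd : DifferentiableOn ℂ F disc := hgd.const_smul _
  have hFn : ∀ z, ‖F z‖ = (squareSize ω ‖a‖ ^ (1 / P))⁻¹ *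
      ((1 - ‖a‖) / ‖1 - b * z‖) ^ m := by
    intro z
    rw [hF, Pi.smul_apply, norm_smul, Complex.norm_real, Real.norm_of_nonneg ht0'.le, ht, hg,
      norm_inv, norm_pow, div_pow]
    ring
  have hFP : ∀ z, ‖F z‖ ^ P = (squareSize ω ‖a‖)⁻¹ *
      ((1 - ‖a‖) / ‖1 - b * z‖) ^ ((m : ℝ) * P) := by
    intro z
    rw [hFn, Real.mul_rpow (by positivity) (by positivity), Real.inv_rpow (by positivity),
      ← Real.rpow_mul hsq.le, one_div_mul_cancel hP0.ne', Real.rpow_one, ← Real.rpow_natCast,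
      ← Real.rpow_mul (by positivity)]
  have hFm : Measurable F := by
    simp only [hF, hg]
    fun_prop
  have hmem : MemLp F p (weightMeasure ω) := by
    refine MemLp.of_bound hFm.aestronglyMeasurable ((squareSize ω ‖a‖ ^ (1 / P))⁻¹) ?_
    filter_upwards [ae_weightMeasure_mem_disc ω] with z hz
    rw [hFn]
    refine mul_le_of_le_one_right (by positivity) (pow_le_one₀ (by positivity) ?_)
    exact div_le_one_of_le₀ (hlow z hz) (norm_nonneg _)
  refine ⟨Bergman.ofFun F hFd hmem, ?_, ?_, ?_⟩
  · rw [Bergman.norm_def, eLpNorm_congr_ae (Bergman.ofFun_ae_eq hFd hmem)]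
    refine ENNReal.toReal_le_of_le_ofReal (by positivity) ?_
    rw [← ENNReal.rpow_le_rpow_iff hP0, eLpNorm_rpow_toReal hp0 hp,
      ENNReal.ofReal_rpow_of_nonneg (by positivity) hP0.le, ← Real.rpow_mul (by positivity),
      one_div_mul_cancel hP0.ne', Real.rpow_one]
    calc ∫⁻ z, ‖F z‖ₑ ^ P ∂weightMeasure ω
        = ∫⁻ z, ENNReal.ofReal (squareSize ω ‖a‖)⁻¹ *
          ENNReal.ofReal (((1 - ‖a‖) / ‖1 - b * z‖) ^ ((m : ℝ) * P)) ∂weightMeasure ω := by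
          refine lintegral_congr fun z => ?_
          rw [← ofReal_norm, ENNReal.ofReal_rpow_of_nonneg (norm_nonneg _) hP0.le, hFP,
            ENNReal.ofReal_mul (by positivity)]
      _ ≤ ENNReal.ofReal (squareSize ω ‖a‖)⁻¹ *
          ENNReal.ofReal (4 * C₁ * squareSize ω ‖a‖) := by
          rw [lintegral_const_mul' _ _ ENNReal.ofReal_ne_top]
          gcongr
          exact lintegral_kernel_le hr hC₁ hup hγ2 hγ1 ha1
      _ = _ := by
          rw [← ENNReal.ofReal_mul (by positivity)]
          congr 1
          field_simp
  · intro R hR z hz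
    have hz1 : ‖z‖ < 1 := hz.trans_lt hR
    rw [Bergman.toFun_ofFun, indicator_of_mem (show z ∈ disc by simpa using hz1), hFP]
    have hR0 : 0 < 1 - R := by linarith
    have h1 : 1 - R ≤ ‖1 - b * z‖ := by
      have := one_sub_le_norm_one_sub_conj_mul (a := a) hz
      have hR' := (norm_nonneg z).trans hz
      nlinarith
    have h2 := rpow_mul_tail_zero_le hr hC₁ hup (by linarith) hm ha0 ha1
    have hta := hω0 ‖a‖ ⟨ha0, ha1⟩
    have e : (1 - ‖a‖) ^ ((m : ℝ) * P) = (1 - ‖a‖) ^ ((m : ℝ) * P - 2) * (1 - ‖a‖) ^ 2 := by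
      rw [← Real.rpow_natCast, ← Real.rpow_add h1a]
      congr 1
      push_cast
      ring
    calc (squareSize ω ‖a‖)⁻¹ * ((1 - ‖a‖) / ‖1 - b * z‖) ^ ((m : ℝ) * P)
        ≤ (squareSize ω ‖a‖)⁻¹ * ((1 - ‖a‖) / (1 - R)) ^ ((m : ℝ) * P) := by gcongr
      _ = ((1 - ‖a‖) ^ ((m : ℝ) * P - 2) * tail ω 0) * (1 - ‖a‖) /
          (tail ω ‖a‖ * tail ω 0) * ((1 - R) ^ ((m : ℝ) * P))⁻¹ := by
          rw [Real.div_rpow h1a.le hR0.le, e, squareSize]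
          field_simp
      _ ≤ (2 * C₁ * tail ω ‖a‖) * (1 - ‖a‖) /
          (tail ω ‖a‖ * tail ω 0) * ((1 - R) ^ ((m : ℝ) * P))⁻¹ := by gcongr
      _ = _ := by field_simp
  · intro ha2 z hz
    have hz1 : z ∈ disc := hz.1
    rw [Bergman.iteratedDeriv_ofFun hFd hmem n hz1]
    have hcd : ContDiffAt ℂ n g z :=
      (hgd.analyticAt (Metric.isOpen_ball.mem_nhds hz1)).contDiffAt
    rw [hF, iteratedDeriv_const_smul hcd, norm_smul, Complex.norm_real,
      Real.norm_of_nonneg ht0'.le, hg, iteratedDeriv_inv_pow_kernel (by rwa [hbn]) m n z hz1,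
      norm_mul, norm_mul, norm_pow, norm_inv, norm_pow, hbn, Complex.norm_natCast, ht]
    have hX := norm_one_sub_le_of_mem_pseudoDisc hs1 ha1 hz
    have hX0 : 0 < ‖1 - b * z‖ := norm_pos_iff.2 (hne z hz1)
    have hs : 0 < 1 - s := by linarith
    have hasc : (1 : ℝ) ≤ m.ascFactorial n := by
      obtain ⟨k, rfl⟩ : ∃ k, m = k + 1 := ⟨m - 1, by omega⟩
      exact_mod_cast Nat.ascFactorial_pos k n
    calc (1 / 2) ^ n * ((1 - s) / 2) ^ (m + n) * ((1 - ‖a‖) ^ n)⁻¹ *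
          (squareSize ω ‖a‖ ^ (1 / P))⁻¹
        = (squareSize ω ‖a‖ ^ (1 / P))⁻¹ * (1 - ‖a‖) ^ m *
          (1 * (1 / 2) ^ n * ((2 * (1 - ‖a‖) / (1 - s)) ^ (m + n))⁻¹) := by
          rw [div_pow (1 - s), div_pow (2 * (1 - ‖a‖)), mul_pow, pow_add (1 - ‖a‖)]
          field_simp
      _ ≤ _ := by gcongr

/-! ### Compact operators and functions concentrating at the circle -/

theorem eLpNorm_rpow_add_compl {α : Type*} {m : MeasurableSpace α} {μ : Measure α} (hp0 : p ≠ 0)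
    (hp : p ≠ ∞) (f : α → ℂ) {E : Set α} (hE : MeasurableSet E) :
    eLpNorm f p μ ^ p.toReal =
      eLpNorm f p (μ.restrict E) ^ p.toReal + eLpNorm f p (μ.restrict Eᶜ) ^ p.toReal := by
  rw [eLpNorm_rpow_toReal hp0 hp, eLpNorm_rpow_toReal hp0 hp, eLpNorm_rpow_toReal hp0 hp,
    lintegral_add_compl _ hE]

/-- The mass of a function in the Bergman space near the circle is small. -/
theorem Bergman.exists_eLpNorm_compl_closedBall_le [hp1 : Fact (1 ≤ p)] (hω : IsRadialWeight ω)
    (hp : p ≠ ∞) (f : Bergman p ω) {δ : ℝ} (hδ : 0 < δ) :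
    ∃ R < 1, eLpNorm f.toFun p ((weightMeasure ω).restrict (Metric.closedBall 0 R)ᶜ) ≤
      ENNReal.ofReal δ := by
  have hp0 : p ≠ 0 := (zero_lt_one.trans_le hp1.out).ne'
  have hP0 : 0 < p.toReal := ENNReal.toReal_pos hp0 hp
  have := hω.isFiniteMeasure_weightMeasure
  set r : ℕ → ℝ := fun k => 1 - 1 / ((k : ℝ) + 1) with hr
  set A : ℕ → Set ℂ := fun k => (Metric.closedBall 0 (r k))ᶜ with hA
  have hAm : ∀ k, MeasurableSet (A k) := fun k => measurableSet_closedBall.compl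
  have hanti : Antitone A := fun i j hij => by
    refine compl_subset_compl.2 (Metric.closedBall_subset_closedBall ?_)
    simp only [hr]
    gcongr
  have hμ : Tendsto (fun k => weightMeasure ω (A k)) atTop (𝓝 0) := by
    have h := tendsto_measure_iInter_atTop (μ := weightMeasure ω)
      (fun k => (hAm k).nullMeasurableSet) hanti ⟨0, measure_ne_top _ _⟩
    have h0 : weightMeasure ω (⋂ k, A k) = 0 := by
      refine measure_mono_null ?_ (ae_iff.1 (ae_weightMeasure_mem_disc ω))
      intro z hz hzd
      have hz1 : ‖z‖ < 1 := by simpa using hzd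
      obtain ⟨k, hk⟩ := exists_nat_one_div_lt (show 0 < 1 - ‖z‖ by linarith)
      have h1 := mem_iInter.1 hz k
      simp only [hA, hr, mem_compl_iff, Metric.mem_closedBall, dist_zero_right, not_le] at h1
      linarith
    rwa [h0] at h
  have hint : ∫⁻ z, ‖f.toFun z‖ₑ ^ p.toReal ∂weightMeasure ω ≠ ∞ := by
    rw [f.lintegral_eq hp0 hp]
    exact ENNReal.rpow_ne_top_of_nonneg hP0.le enorm_ne_top
  have hlim := tendsto_setLIntegral_zero hint hμ
  have hδ' : 0 < ENNReal.ofReal δ ^ p.toReal :=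
    ENNReal.rpow_pos (by simpa using hδ) ENNReal.ofReal_ne_top
  obtain ⟨k, hk⟩ := (hlim.eventually (gt_mem_nhds hδ')).exists
  refine ⟨r k, ?_, ?_⟩
  · have : (0 : ℝ) < 1 / ((k : ℝ) + 1) := by positivity
    simp only [hr]
    linarith
  · rw [← ENNReal.rpow_le_rpow_iff hP0, eLpNorm_rpow_toReal hp0 hp]
    exact hk.le

/-- Adding a function of norm at most `B` far out in a sequence that vanishes on compact subsets
increases the `p`-th power of the norm by hardly more than `B^p`. -/
theorem Bergman.eventually_norm_add_rpow_le [hp1 : Fact (1 ≤ p)] (hω : IsRadialWeight ω)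
    (hp : p ≠ ∞) {f : ℕ → Bergman p ω} {B : ℝ} (hB : ∀ j, ‖f j‖ ≤ B)
    (hf : ∀ R < 1, Tendsto (fun j => eLpNorm (f j).toFun p
      ((weightMeasure ω).restrict (Metric.closedBall 0 R))) atTop (𝓝 0)) (F : Bergman p ω) :
    ∀ᶠ j in atTop, ‖F + f j‖ ^ p.toReal ≤ ‖F‖ ^ p.toReal + (B ^ p.toReal + 1) := by
  have hp0 : p ≠ 0 := (zero_lt_one.trans_le hp1.out).ne'
  set P := p.toReal with hPdef
  have hP0 : 0 < P := ENNReal.toReal_pos hp0 hp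
  have hB0 : 0 ≤ B := (norm_nonneg _).trans (hB 0)
  obtain ⟨δ, hδ, hδP⟩ : ∃ δ > 0, (‖F‖ + δ) ^ P + (δ + B) ^ P ≤ ‖F‖ ^ P + (B ^ P + 1) := by
    have hc : Continuous fun δ : ℝ => (‖F‖ + δ) ^ P + (δ + B) ^ P :=
      ((continuous_const.add continuous_id).rpow_const fun _ => Or.inr hP0.le).add
        ((continuous_id.add continuous_const).rpow_const fun _ => Or.inr hP0.le)
    have h1 : (fun δ : ℝ => (‖F‖ + δ) ^ P + (δ + B) ^ P) 0 < ‖F‖ ^ P + (B ^ P + 1) := by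
      simp only [add_zero, zero_add]
      linarith
    have h2 := (hc.tendsto 0).eventually (gt_mem_nhds h1)
    obtain ⟨δ, h3, h4⟩ := ((h2.filter_mono nhdsWithin_le_nhds).and
      (self_mem_nhdsWithin (s := Ioi (0 : ℝ)))).exists
    exact ⟨δ, h4, h3.le⟩
  obtain ⟨R, hR, hFR⟩ := F.exists_eLpNorm_compl_closedBall_le hω hp hδ
  have hδe : 0 < ENNReal.ofReal δ := by simpa using hδ
  filter_upwards [(hf R hR).eventually (gt_mem_nhds hδe)] with j hj
  have hFm := F.measurable.aestronglyMeasurable (μ := weightMeasure ω)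
  have hfm := (f j).measurable.aestronglyMeasurable (μ := weightMeasure ω)
  have hBj : eLpNorm (f j).toFun p (weightMeasure ω) ≤ ENNReal.ofReal B := by
    rw [← Bergman.enorm_def, ← ofReal_norm]
    exact ENNReal.ofReal_le_ofReal (hB j)
  have hFe : eLpNorm F.toFun p (weightMeasure ω) = ENNReal.ofReal ‖F‖ := by
    rw [← Bergman.enorm_def, ofReal_norm]
  have h1 : eLpNorm (F.toFun + (f j).toFun) p
      ((weightMeasure ω).restrict (Metric.closedBall 0 R)) ≤ ENNReal.ofReal (‖F‖ + δ) := by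
    rw [ENNReal.ofReal_add (norm_nonneg _) hδ.le, ← hFe]
    exact (eLpNorm_add_le hFm.restrict hfm.restrict hp1.out).trans
      (add_le_add (eLpNorm_mono_measure _ Measure.restrict_le_self) hj.le)
  have h2 : eLpNorm (F.toFun + (f j).toFun) p
      ((weightMeasure ω).restrict (Metric.closedBall 0 R)ᶜ) ≤ ENNReal.ofReal (δ + B) := by
    rw [ENNReal.ofReal_add hδ.le hB0]
    exact (eLpNorm_add_le hFm.restrict hfm.restrict hp1.out).trans
      (add_le_add hFR ((eLpNorm_mono_measure _ Measure.restrict_le_self).trans hBj))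
  have h3 : ‖F + f j‖ₑ ^ P ≤ ENNReal.ofReal ((‖F‖ + δ) ^ P + (δ + B) ^ P) := by
    rw [Bergman.enorm_def, Bergman.toFun_add,
      eLpNorm_rpow_add_compl hp0 hp _ (measurableSet_closedBall (x := (0 : ℂ)) (ε := R)),
      ENNReal.ofReal_add (by positivity) (by positivity),
      ← ENNReal.ofReal_rpow_of_nonneg (by positivity) hP0.le,
      ← ENNReal.ofReal_rpow_of_nonneg (by positivity) hP0.le]
    exact add_le_add (ENNReal.rpow_le_rpow h1 hP0.le) (ENNReal.rpow_le_rpow h2 hP0.le)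
  rw [← ofReal_norm, ENNReal.ofReal_rpow_of_nonneg (norm_nonneg _) hP0.le,
    ENNReal.ofReal_le_ofReal_iff (by positivity)] at h3
  exact h3.trans hδP

/-- A compact operator sends a bounded sequence that vanishes on compact subsets to a null sequence.
Otherwise, along a subsequence the images tend to some `g ≠ 0`, and a sum of `N` suitably sparse
members has norm `O(N^(1/p))` while its image is close to `N g`; this contradicts `p > 1`. -/
theorem Bergman.tendsto_compactOperator [hp1 : Fact (1 ≤ p)] (hω : IsRadialWeight ω)
    (hp1' : 1 < p) (hp : p ≠ ∞) {Y : Type*} [NormedAddCommGroup Y] [NormedSpace ℂ Y]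
    {K : Bergman p ω →L[ℂ] Y} (hK : IsCompactOperator K) {f : ℕ → Bergman p ω} {B : ℝ}
    (hB : ∀ j, ‖f j‖ ≤ B)
    (hf : ∀ R < 1, Tendsto (fun j => eLpNorm (f j).toFun p
      ((weightMeasure ω).restrict (Metric.closedBall 0 R))) atTop (𝓝 0)) :
    Tendsto (fun j => ‖K (f j)‖) atTop (𝓝 0) := by
  set P := p.toReal with hPdef
  have hP1 : 1 < P := by
    simpa using (ENNReal.toReal_lt_toReal ENNReal.one_ne_top hp).2 hp1'
  have hP0 : 0 < P := by linarith
  by_contra hnot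
  obtain ⟨ε, hε, hfr⟩ : ∃ ε > 0, ∃ᶠ j in atTop, ε ≤ ‖K (f j)‖ := by
    rw [Metric.tendsto_atTop] at hnot
    push Not at hnot
    obtain ⟨ε, hε, h⟩ := hnot
    refine ⟨ε, hε, frequently_atTop.2 fun N => ?_⟩
    obtain ⟨j, hj, hj'⟩ := h N
    exact ⟨j, hj, by simpa using hj'⟩
  obtain ⟨φ, hφ, hφε⟩ := extraction_of_frequently_atTop hfr
  obtain ⟨S, hS, hKS⟩ := hK.image_closedBall_subset_compact (f := (K : Bergman p ω →ₗ[ℂ] Y)) B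
  obtain ⟨g, -, ψ, hψ, hlim⟩ := hS.tendsto_subseq (x := fun j => K (f (φ j)))
    fun j => hKS ⟨f (φ j), by simpa using hB (φ j), rfl⟩
  have hg : ε ≤ ‖g‖ := ge_of_tendsto' hlim.norm fun j => hφε (ψ j)
  have hg0 : 0 < ‖g‖ := hε.trans_le hg
  set h : ℕ → Bergman p ω := fun j => f (φ (ψ j)) with hh
  have hhB : ∀ j, ‖h j‖ ≤ B := fun j => hB _
  have hhf : ∀ R < 1, Tendsto (fun j => eLpNorm (h j).toFun p
      ((weightMeasure ω).restrict (Metric.closedBall 0 R))) atTop (𝓝 0) := fun R hR =>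
    (hf R hR).comp (hφ.comp hψ).tendsto_atTop
  have hclose : ∀ᶠ j in atTop, ‖K (h j) - g‖ ≤ ‖g‖ / 2 := by
    have h1 : Tendsto (fun j => ‖K (h j) - g‖) atTop (𝓝 0) :=
      tendsto_iff_norm_sub_tendsto_zero.1 hlim
    filter_upwards [h1.eventually (gt_mem_nhds (half_pos hg0))] with j hj using hj.le
  have hB0 : 0 ≤ B := (norm_nonneg _).trans (hB 0)
  -- `F` is a sum of `N` members of the sequence, each chosen far out in terms of the previous ones.
  have hsum : ∀ N : ℕ, ∃ F : Bergman p ω, ‖F‖ ^ P ≤ N * (B ^ P + 1) ∧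
      ‖K F - N • g‖ ≤ N * (‖g‖ / 2) := by
    intro N
    induction N with
    | zero => exact ⟨0, by simp [Real.zero_rpow hP0.ne'], by simp⟩
    | succ N ih =>
      obtain ⟨F, hF1, hF2⟩ := ih
      obtain ⟨j, hj1, hj2⟩ :=
        ((Bergman.eventually_norm_add_rpow_le hω hp hhB hhf F).and hclose).exists
      refine ⟨F + h j, ?_, ?_⟩
      · push_cast
        linarith
      · rw [map_add, succ_nsmul, add_sub_add_comm]
        push_cast
        linarith [norm_add_le (K F - N • g) (K (h j) - g)]
  have hbound : ∀ N : ℕ, 0 < N → (N : ℝ) ^ (P - 1) * (‖g‖ / 2) ^ P ≤ ‖K‖ ^ P * (B ^ P + 1) := by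
    intro N hN
    have hN0 : (0 : ℝ) < N := by exact_mod_cast hN
    obtain ⟨F, hF1, hF2⟩ := hsum N
    have h1 : (N : ℝ) * (‖g‖ / 2) ≤ ‖K‖ * ‖F‖ := by
      have h2 : ‖(N : ℕ) • g‖ = N * ‖g‖ := by
        rw [← Nat.cast_smul_eq_nsmul ℝ, norm_smul, Real.norm_natCast]
      have h3 := norm_sub_norm_le (N • g) (N • g - K F)
      rw [sub_sub_cancel, h2, norm_sub_rev] at h3
      linarith [K.le_opNorm F]
    have h4 := Real.rpow_le_rpow (by positivity) h1 hP0.le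
    rw [Real.mul_rpow hN0.le (by positivity), Real.mul_rpow (norm_nonneg _) (norm_nonneg _)] at h4
    have e : (N : ℝ) ^ P = N ^ (P - 1) * N := by
      rw [← Real.rpow_add_one hN0.ne', sub_add_cancel]
    have h5 : ‖K‖ ^ P * ‖F‖ ^ P ≤ ‖K‖ ^ P * (N * (B ^ P + 1)) := by gcongr
    rw [e] at h4
    refine le_of_mul_le_mul_right (a := (N : ℝ)) ?_ hN0
    calc _ = (N : ℝ) ^ (P - 1) * N * (‖g‖ / 2) ^ P := by ring
      _ ≤ _ := h4.trans h5
      _ = _ := by ring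
  have hinf : Tendsto (fun N : ℕ => (N : ℝ) ^ (P - 1) * (‖g‖ / 2) ^ P) atTop atTop :=
    ((tendsto_rpow_atTop (by linarith)).comp tendsto_natCast_atTop_atTop).atTop_mul_const
      (by positivity)
  obtain ⟨N, hN1, hN2⟩ := ((hinf.eventually_gt_atTop (‖K‖ ^ P * (B ^ P + 1))).and
    (eventually_gt_atTop 0)).exists
  exact absurd (hbound N hN2) (not_le.2 hN1)

/-! ### The two estimates of the essential norm -/

theorem eventually_comap_norm_iff {Q : ℂ → Prop} :
    (∀ᶠ z in comap (fun z : ℂ => ‖z‖) (𝓝[<] 1), Q z) ↔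
      ∃ R < 1, ∀ z : ℂ, R < ‖z‖ → ‖z‖ < 1 → Q z := by
  have hb := (nhdsLT_basis (1 : ℝ)).comap (fun z : ℂ => ‖z‖)
  rw [hb.eventually_iff]
  constructor
  · rintro ⟨R, hR, h⟩
    exact ⟨R, hR, fun z h1 h2 => h ⟨h1, h2⟩⟩
  · rintro ⟨R, hR, h⟩
    exact ⟨R, hR, fun z hz => h z hz.1 hz.2⟩

theorem measurableSet_pseudoDisc (s : ℝ) (a : ℂ) : MeasurableSet (pseudoDisc s a) := by
  have h : Measurable fun z : ℂ => ‖(a - z) / (1 - (starRingEnd ℂ) a * z)‖ := by fun_prop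
  exact measurableSet_ball.inter (measurableSet_lt h measurable_const)

/-- The upper estimate. Any `M` above the limsup bounds the quotients for `|z|` close to `1`, and
the embedding near the circle then bounds the tail of the operator. -/
theorem exists_essNorm_le [hp1 : Fact (1 ≤ p)] [hq1 : Fact (1 ≤ q)] (hpq : p ≤ q) (hq : q ≠ ∞)
    (n : ℕ) (hω : IsTwoSidedDoubling ω) (hω0 : ∀ r ∈ Ico (0 : ℝ) 1, 0 < tail ω r) {s : ℝ}
    (hs0 : 0 < s) (hs1 : s < 1) :
    ∃ C : ℝ, 0 < C ∧ ∀ (μ : Measure ℂ) (hμ : DiffBounded p q ω n μ),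
      ENNReal.ofReal (essNorm hμ.operator ^ q.toReal) ≤
        ENNReal.ofReal C * limsup (fun z : ℂ => carlesonQuotient p q ω n s μ z)
          (comap (fun z : ℂ => ‖z‖) (𝓝[<] 1)) := by
  have hp : p ≠ ∞ := ne_top_of_le_ne_top hq hpq
  have hp0 : p ≠ 0 := (zero_lt_one.trans_le hp1.out).ne'
  have hq0 : q ≠ 0 := (zero_lt_one.trans_le hq1.out).ne'
  have hP := one_le_toReal hp1.out hp
  have hPQ := ENNReal.toReal_mono hq hpq
  obtain ⟨C, hC, hemb⟩ := hω.exists_embedding hP hPQ n hs0 hs1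
  refine ⟨C, hC, fun μ hμ => ?_⟩
  set P := p.toReal with hPdef
  set Q := q.toReal with hQdef
  have hP0 : 0 < P := by linarith
  have hQ0 : 0 < Q := by linarith
  have hr := hω.toIsRadialWeight
  have := hr.isFiniteMeasure_weightMeasure
  have hfin := hμ.isFiniteMeasure hr hq0 hq
  have hCe : ENNReal.ofReal C ≠ 0 := by simpa using hC
  refine (ENNReal.div_le_iff' hCe ENNReal.ofReal_ne_top).1
    (le_of_forall_gt_imp_ge_of_dense fun M hM => ?_)
  rcases eq_or_ne M ∞ with rfl | hMt
  · exact le_top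
  rw [ENNReal.div_le_iff' hCe ENNReal.ofReal_ne_top]
  obtain ⟨R, hR, hRq⟩ := eventually_comap_norm_iff.1 (eventually_lt_of_limsup_lt hM)
  set R₁ := max R (1 / 2) with hR₁
  have hR₁1 : R₁ < 1 := max_lt hR (by norm_num)
  have hR₁2 : 1 / 2 ≤ R₁ := le_max_right _ _
  have hmeas : ∀ w ∈ disc, R₁ < ‖w‖ → μ (pseudoDisc s w) ≤
      M * (ENNReal.ofReal (1 - ‖w‖) ^ (n * Q) * ENNReal.ofReal (squareSize ω ‖w‖) ^ (Q / P)) := by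
    intro w hw hRw
    have hw1 : ‖w‖ < 1 := by simpa using hw
    have hw2 : 1 / 2 ≤ ‖w‖ := hR₁2.trans hRw.le
    have h1 := (hRq w ((le_max_left _ _).trans_lt hRw) hw1).le
    have hsq := squareSize_pos hω0 (norm_nonneg w) hw1
    have hπ := Real.pi_pos
    have hS0 : weightMeasure ω (carlesonSquare w) ≠ 0 := by
      refine (lt_of_lt_of_le ?_ (hr.le_weightMeasure_carlesonSquare hw2 hw1)).ne'
      rw [ENNReal.ofReal_pos]
      positivity
    have hu0 : ENNReal.ofReal (1 - ‖w‖) ≠ 0 := by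
      rw [ne_eq, ENNReal.ofReal_eq_zero]
      linarith
    have hd0 : ENNReal.ofReal (1 - ‖w‖) ^ (n * Q) *
        weightMeasure ω (carlesonSquare w) ^ (Q / P) ≠ 0 := by
      refine mul_ne_zero ?_ ?_
      · exact (ENNReal.rpow_pos (pos_iff_ne_zero.2 hu0) ENNReal.ofReal_ne_top).ne'
      · exact (ENNReal.rpow_pos (pos_iff_ne_zero.2 hS0) (measure_ne_top _ _)).ne'
    have hdt : ENNReal.ofReal (1 - ‖w‖) ^ (n * Q) *
        weightMeasure ω (carlesonSquare w) ^ (Q / P) ≠ ∞ :=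
      ENNReal.mul_ne_top (ENNReal.rpow_ne_top_of_nonneg (by positivity) ENNReal.ofReal_ne_top)
        (ENNReal.rpow_ne_top_of_nonneg (by positivity) (measure_ne_top _ _))
    rw [carlesonQuotient, ENNReal.div_le_iff hd0 hdt] at h1
    refine h1.trans ?_
    gcongr
    exact hr.weightMeasure_carlesonSquare_le (norm_pos_iff.1 (by linarith)) hw1
  set D := ((ENNReal.ofReal C * M) ^ (1 / Q)).toReal with hD
  have hDt : (ENNReal.ofReal C * M) ^ (1 / Q) ≠ ∞ :=
    ENNReal.rpow_ne_top_of_nonneg (by positivity) (ENNReal.mul_ne_top ENNReal.ofReal_ne_top hMt)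
  have hess : essNorm hμ.operator ≤ D := by
    refine hμ.essNorm_le_of_tail hω hω0 hp hq (R := (2 * R₁ + 1) / 3) (by linarith) (by linarith)
      ENNReal.toReal_nonneg fun f => ?_
    have hI : ∫⁻ z, ‖f.toFun z‖ₑ ^ P ∂weightMeasure ω ≠ ∞ := by
      rw [f.lintegral_eq hp0 hp]
      exact ENNReal.rpow_ne_top_of_nonneg hP0.le enorm_ne_top
    have h := hemb μ hfin M R₁ hMt hmeas f.toFun f.differentiableOn f.measurable hI
    rw [← ENNReal.rpow_le_rpow_iff hQ0, eLpNorm_rpow_toReal hq0 hq]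
    refine h.trans_eq ?_
    rw [f.lintegral_eq hp0 hp, ENNReal.ofReal_mul ENNReal.toReal_nonneg,
      ENNReal.ofReal_toReal hDt, ofReal_norm, ENNReal.mul_rpow_of_nonneg _ _ hQ0.le,
      ← ENNReal.rpow_mul, ← ENNReal.rpow_mul, one_div_mul_cancel hQ0.ne', ENNReal.rpow_one,
      mul_div_cancel₀ Q hP0.ne']
  calc ENNReal.ofReal (essNorm hμ.operator ^ Q) ≤ ENNReal.ofReal (D ^ Q) :=
        ENNReal.ofReal_le_ofReal (Real.rpow_le_rpow (essNorm_nonneg _) hess hQ0.le)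
    _ = ENNReal.ofReal C * M := by
        rw [← ENNReal.ofReal_rpow_of_nonneg ENNReal.toReal_nonneg hQ0.le,
          ENNReal.ofReal_toReal hDt, ← ENNReal.rpow_mul, one_div_mul_cancel hQ0.ne',
          ENNReal.rpow_one]

/-- A function whose `n`-th derivative is large on the pseudohyperbolic disc at `a` tests the
operator against the quotient at `a`. -/
theorem carlesonQuotient_le [hp1 : Fact (1 ≤ p)] [hq1 : Fact (1 ≤ q)] (hp : p ≠ ∞) (hq : q ≠ ∞)
    {n : ℕ} (hω : IsTwoSidedDoubling ω) (hω0 : ∀ r ∈ Ico (0 : ℝ) 1, 0 < tail ω r) {s c : ℝ}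
    (hc : 0 < c) {μ : Measure ℂ} (hμ : DiffBounded p q ω n μ) {a : ℂ} (ha : 1 / 2 ≤ ‖a‖)
    (ha1 : ‖a‖ < 1) (f : Bergman p ω)
    (hf : ∀ z ∈ pseudoDisc s a,
        c * ((1 - ‖a‖) ^ n)⁻¹ * (squareSize ω ‖a‖ ^ (1 / p.toReal))⁻¹ ≤
          ‖iteratedDeriv n f.toFun z‖) :
    carlesonQuotient p q ω n s μ a ≤
      ENNReal.ofReal ((2 * Real.pi) ^ (q.toReal / p.toReal) / c ^ q.toReal *
        ‖hμ.operator f‖ ^ q.toReal) := by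
  have hq0 : q ≠ 0 := (zero_lt_one.trans_le hq1.out).ne'
  have hP := one_le_toReal hp1.out hp
  have hQ := one_le_toReal hq1.out hq
  set P := p.toReal with hPdef
  set Q := q.toReal with hQdef
  have hP0 : 0 < P := by linarith
  have hQ0 : 0 < Q := by linarith
  have hπ := Real.pi_pos
  have hu : 0 < 1 - ‖a‖ := by linarith
  have hsq := squareSize_pos hω0 (norm_nonneg a) ha1
  set κ := c * ((1 - ‖a‖) ^ n)⁻¹ * (squareSize ω ‖a‖ ^ (1 / P))⁻¹ with hκ
  have hκ0 : 0 < κ := by positivity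
  have hE := measurableSet_pseudoDisc s a
  have hEd : pseudoDisc s a ⊆ disc := fun z hz => hz.1
  have h1 : ENNReal.ofReal (κ ^ Q) * μ (pseudoDisc s a) ≤ ‖hμ.operator f‖ₑ ^ Q := by
    have he : ‖hμ.operator f‖ₑ = eLpNorm (iteratedDeriv n f.toFun) q (μ.restrict disc) :=
      Lp.enorm_toLp (hμ.memLp f)
    rw [he, eLpNorm_rpow_toReal hq0 hq]
    calc _ = ∫⁻ z in pseudoDisc s a, ENNReal.ofReal (κ ^ Q) ∂μ := by rw [setLIntegral_const]
      _ ≤ ∫⁻ z in pseudoDisc s a, ‖iteratedDeriv n f.toFun z‖ₑ ^ Q ∂μ := by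
          refine setLIntegral_mono' hE fun z hz => ?_
          rw [← ofReal_norm, ENNReal.ofReal_rpow_of_nonneg (norm_nonneg _) hQ0.le]
          exact ENNReal.ofReal_le_ofReal (Real.rpow_le_rpow hκ0.le (hf z hz) hQ0.le)
      _ ≤ _ := lintegral_mono' (Measure.restrict_mono hEd le_rfl) le_rfl
  have h2 : carlesonQuotient p q ω n s μ a ≤ μ (pseudoDisc s a) /
      ENNReal.ofReal ((1 - ‖a‖) ^ (n * Q) * (squareSize ω ‖a‖ / (2 * Real.pi)) ^ (Q / P)) := by
    rw [carlesonQuotient, ENNReal.ofReal_mul (by positivity), ← ENNReal.ofReal_rpow_of_pos hu,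
      ← ENNReal.ofReal_rpow_of_pos (by positivity)]
    gcongr
    exact hω.le_weightMeasure_carlesonSquare ha ha1
  have hκQ : κ ^ Q = c ^ Q * ((1 - ‖a‖) ^ (n * Q))⁻¹ * (squareSize ω ‖a‖ ^ (Q / P))⁻¹ := by
    rw [hκ, Real.mul_rpow (by positivity) (by positivity),
      Real.mul_rpow (by positivity) (by positivity), Real.inv_rpow (by positivity),
      Real.inv_rpow (by positivity), ← Real.rpow_mul hsq.le, ← Real.rpow_natCast,
      ← Real.rpow_mul hu.le, one_div_mul_eq_div]
  have e : (2 * Real.pi) ^ (Q / P) / c ^ Q * κ ^ Q =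
      ((1 - ‖a‖) ^ (n * Q) * (squareSize ω ‖a‖ / (2 * Real.pi)) ^ (Q / P))⁻¹ := by
    rw [hκQ, Real.div_rpow hsq.le (by positivity)]
    field_simp
  calc _ ≤ _ := h2
    _ = ENNReal.ofReal ((2 * Real.pi) ^ (Q / P) / c ^ Q) *
        (ENNReal.ofReal (κ ^ Q) * μ (pseudoDisc s a)) := by
        rw [← mul_assoc, ← ENNReal.ofReal_mul (by positivity), e, div_eq_mul_inv,
          ENNReal.ofReal_inv_of_pos (by positivity), mul_comm]
    _ ≤ ENNReal.ofReal ((2 * Real.pi) ^ (Q / P) / c ^ Q) * ‖hμ.operator f‖ₑ ^ Q := by gcongr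
    _ = _ := by
        rw [← ofReal_norm, ENNReal.ofReal_rpow_of_nonneg (norm_nonneg _) hQ0.le,
          ← ENNReal.ofReal_mul (by positivity)]

/-- The lower estimate. For compact `K`, test `T - K` on test functions at points `a` tending to
the circle along which the quotient tends to its limsup; `K` does not contribute in the limit. -/
theorem exists_le_essNorm [hp1 : Fact (1 ≤ p)] [hq1 : Fact (1 ≤ q)] (hp1' : 1 < p) (hp : p ≠ ∞)
    (hq : q ≠ ∞) (n : ℕ) (hω : IsTwoSidedDoubling ω) (hω0 : ∀ r ∈ Ico (0 : ℝ) 1, 0 < tail ω r)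
    {s : ℝ} (hs1 : s < 1) :
    ∃ C : ℝ, 0 < C ∧ ∀ (μ : Measure ℂ) (hμ : DiffBounded p q ω n μ),
      limsup (fun z : ℂ => carlesonQuotient p q ω n s μ z)
          (comap (fun z : ℂ => ‖z‖) (𝓝[<] 1)) ≤
        ENNReal.ofReal C * ENNReal.ofReal (essNorm hμ.operator ^ q.toReal) := by
  have hp0 : p ≠ 0 := (zero_lt_one.trans_le hp1.out).ne'
  have hQ0 : 0 < q.toReal := by linarith [one_le_toReal hq1.out hq]
  have hP0 : 0 < p.toReal := by linarith [one_le_toReal hp1.out hp]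
  obtain ⟨B, c, hB, hc, D, hD⟩ := hω.exists_testFunctions (p := p) hω0 hp n hs1
  have hr := hω.toIsRadialWeight
  have := hr.isFiniteMeasure_weightMeasure
  have hπ := Real.pi_pos
  set A := (2 * Real.pi) ^ (q.toReal / p.toReal) / c ^ q.toReal with hA
  have hA0 : 0 < A := by positivity
  refine ⟨A * B ^ q.toReal, by positivity, fun μ hμ => ?_⟩
  set T := hμ.operator with hT
  have hcpt : ∀ K : Bergman p ω →L[ℂ] Lp ℂ q (μ.restrict disc), IsCompactOperator K →
      limsup (fun z : ℂ => carlesonQuotient p q ω n s μ z)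
        (comap (fun z : ℂ => ‖z‖) (𝓝[<] 1)) ≤
      ENNReal.ofReal (A * (‖T - K‖ * B) ^ q.toReal) := by
    intro K hK
    refine le_of_forall_lt_imp_le_of_dense fun l hl => ?_
    have hhalf : ∀ᶠ z : ℂ in comap (fun z : ℂ => ‖z‖) (𝓝[<] 1), 1 / 2 ≤ ‖z‖ ∧ ‖z‖ < 1 :=
      eventually_comap_norm_iff.2 ⟨1 / 2, by norm_num, fun z h1 h2 => ⟨h1.le, h2⟩⟩
    obtain ⟨a, hat, ha⟩ := exists_seq_forall_of_frequently
      ((frequently_lt_of_lt_limsup (by isBoundedDefault) hl).and_eventually hhalf)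
    have han : Tendsto (fun j => ‖a j‖) atTop (𝓝 1) :=
      (tendsto_comap_iff.1 hat).mono_right nhdsWithin_le_nhds
    choose f hfB hfD hfc using fun j => hD (a j) (by simpa using (ha j).2.2)
    have hloc : ∀ R < 1, Tendsto (fun j => eLpNorm (f j).toFun p
        ((weightMeasure ω).restrict (Metric.closedBall 0 R))) atTop (𝓝 0) := by
      intro R hR
      have hlim : Tendsto (fun j => (ENNReal.ofReal (D R * (1 - ‖a j‖)) *
          weightMeasure ω univ) ^ (1 / p.toReal)) atTop (𝓝 0) := by
        have h1 : Tendsto (fun j => D R * (1 - ‖a j‖)) atTop (𝓝 0) := by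
          simpa using (han.const_sub 1).const_mul (D R)
        have h2 := ENNReal.Tendsto.mul_const (ENNReal.tendsto_ofReal h1)
          (Or.inr (measure_ne_top (weightMeasure ω) univ))
        have h3 := h2.ennrpow_const (1 / p.toReal)
        rwa [ENNReal.ofReal_zero, zero_mul, ENNReal.zero_rpow_of_pos (by positivity)] at h3
      refine tendsto_of_tendsto_of_tendsto_of_le_of_le tendsto_const_nhds hlim
        (fun _ => zero_le) fun j => ?_
      rw [one_div, ENNReal.le_rpow_inv_iff hP0, eLpNorm_rpow_toReal hp0 hp]
      calc _ ≤ ∫⁻ z in Metric.closedBall 0 R, ENNReal.ofReal (D R * (1 - ‖a j‖))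
              ∂weightMeasure ω := by
            refine setLIntegral_mono' measurableSet_closedBall fun z hz => ?_
            rw [← ofReal_norm, ENNReal.ofReal_rpow_of_nonneg (norm_nonneg _) hP0.le]
            exact ENNReal.ofReal_le_ofReal (hfD j R hR z (by simpa using hz))
        _ ≤ _ := by
            rw [setLIntegral_const]
            gcongr
            exact subset_univ _
    have hK0 := Bergman.tendsto_compactOperator hr hp1' hp hK hfB hloc
    have hlim : Tendsto (fun j => ENNReal.ofReal
        (A * (‖T - K‖ * B + ‖K (f j)‖) ^ q.toReal)) atTop
        (𝓝 (ENNReal.ofReal (A * (‖T - K‖ * B) ^ q.toReal))) := by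
      refine ENNReal.tendsto_ofReal (Tendsto.const_mul A ?_)
      have h1 := (hK0.const_add (‖T - K‖ * B)).rpow_const (p := q.toReal) (Or.inr hQ0.le)
      rwa [add_zero] at h1
    refine ge_of_tendsto' hlim fun j => ?_
    refine (ha j).1.le.trans ((carlesonQuotient_le hp hq hω hω0 hc hμ (ha j).2.1 (ha j).2.2
      (f j) (hfc j (ha j).2.1)).trans (ENNReal.ofReal_le_ofReal ?_))
    have h1 : ‖T (f j)‖ ≤ ‖T - K‖ * B + ‖K (f j)‖ := by
      have e : T (f j) = (T - K) (f j) + K (f j) := by simp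
      calc ‖T (f j)‖ ≤ ‖(T - K) (f j)‖ + ‖K (f j)‖ := by
            conv_lhs => rw [e]
            exact norm_add_le _ _
        _ ≤ _ := by
            gcongr
            exact ((T - K).le_opNorm _).trans (by gcongr; exact hfB j)
    gcongr
  obtain ⟨u, -, hu, hmem⟩ := exists_seq_tendsto_sInf
    (S := {t : ℝ | ∃ K : Bergman p ω →L[ℂ] Lp ℂ q (μ.restrict disc),
      IsCompactOperator K ∧ t = ‖T - K‖})
    ⟨_, 0, isCompactOperator_zero, rfl⟩ ⟨0, by rintro t ⟨K, -, rfl⟩; exact norm_nonneg _⟩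
  have hlim : Tendsto (fun j => ENNReal.ofReal (A * (u j * B) ^ q.toReal)) atTop
      (𝓝 (ENNReal.ofReal (A * (essNorm T * B) ^ q.toReal))) :=
    ENNReal.tendsto_ofReal
      (Tendsto.const_mul A ((hu.mul_const B).rpow_const (Or.inr hQ0.le)))
  have h := ge_of_tendsto' hlim fun j => by
    obtain ⟨K, hK, hKu⟩ := hmem j
    rw [hKu]
    exact hcpt K hK
  refine h.trans_eq ?_
  rw [Real.mul_rpow (essNorm_nonneg T) hB.le, ← ENNReal.ofReal_mul (by positivity)]
  congr 1
  ring

end BergmanDoubling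

end

theorem theorem2p2 (p q : ℝ≥0∞) [Fact (1 ≤ p)] [Fact (1 ≤ q)]
    (hp : 1 < p) (hpq : p ≤ q) (hq : q < ∞) (n : ℕ)
    (ω : ℝ → ℝ) (hω : BergmanDoubling.IsTwoSidedDoubling ω)
    (hω0 : ∀ r ∈ Ico (0 : ℝ) 1, 0 < BergmanDoubling.tail ω r)
    (s : ℝ) (hs0 : 0 < s) (hs1 : s < 1) :
    ∃ C : ℝ≥0, 0 < C ∧ ∀ (μ : Measure ℂ) (hμ : BergmanDoubling.DiffBounded p q ω n μ),
      ENNReal.ofReal (BergmanDoubling.essNorm hμ.operator ^ q.toReal) ≤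
        C * limsup (fun z : ℂ => BergmanDoubling.carlesonQuotient p q ω n s μ z)
          (comap (fun z : ℂ => ‖z‖) (𝓝[<] 1)) ∧
      limsup (fun z : ℂ => BergmanDoubling.carlesonQuotient p q ω n s μ z)
          (comap (fun z : ℂ => ‖z‖) (𝓝[<] 1)) ≤
        C * ENNReal.ofReal (BergmanDoubling.essNorm hμ.operator ^ q.toReal) := by
  obtain ⟨C₁, hC₁, h₁⟩ := BergmanDoubling.exists_essNorm_le hpq hq.ne n hω hω0 hs0 hs1
  obtain ⟨C₂, -, h₂⟩ :=
    BergmanDoubling.exists_le_essNorm hp (hpq.trans_lt hq).ne hq.ne n hω hω0 hs1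
  refine ⟨(max C₁ C₂).toNNReal, by simp [hC₁], fun μ hμ => ⟨(h₁ μ hμ).trans ?_,
    (h₂ μ hμ).trans ?_⟩⟩
  · exact mul_le_mul_left (ENNReal.ofReal_le_ofReal (le_max_left _ _)) _
  · exact mul_le_mul_left (ENNReal.ofReal_le_ofReal (le_max_right _ _)) _
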